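/- Let $M>0$, $l>0$ and $m>0$ with $ml>1$, and put $F(r)=1-\frac{2M}{r}+\frac{r^2}{l^2}$. Let $r_{SAdS}>0$ be the unique real zero of $F$, let $x(r)=-\int_r^\infty \frac{d\rho}{F(\rho)}$, which is a bijection from $]r_{SAdS},\infty[$ onto $]-\infty,0[$, let $r(x)$ be its inverse, and put $$A(x)=\frac{F(r(x))^{1/2}}{r(x)},\qquad B(x)=F(r(x))^{1/2}.$$ For $h>0$ consider the semiclassical radial Dirac operator $$H=i\gamma^0\gamma^1 h\,\partial_x+\gamma^0\gamma^2A(x)-hm\,\gamma^0B(x)$$ on $L^2(]-\infty,0[;\mathbb C^4)$ with domain $D(H)=\{\varphi\in L^2 : H\varphi\in L^2\}$, where $H\varphi$ is taken in the sense of distributions on $]-\infty,0[$ and $$\gamma^0=i\begin{pmatrix}0&\sigma^0\\-\sigma^0&0\end{pmatrix},\quad \gamma^k=i\begin{pmatrix}0&\sigma^k\\ \sigma^k&0\end{pmatrix}\ (k=1,2),\quad \sigma^0=\begin{pmatrix}1&0\\0&1\end{pmatrix},\ \sigma^1=\begin{pmatrix}1&0\\0&-1\end{pmatrix},\ \sigma^2=\begin{pmatrix}0&1\\1&0\end{pmatrix}.$$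 Let $r_+$ be such that $\frac{F(r)}{4l^2}-\frac{F'(r)^2}{16}\ge 0$ for all $r\ge r_+$, and put $x_+=x(r_+)$. Theorem. Let $S>0$ be such that $\frac1{l^2}+S<A^2(x_+)$. There exist constants $h_0>0$ and $D>0$ and, for every $h\in(0,h_0)$, a real number $E^+(h)$ with $0<E^+(h)<\frac1{l^2}+S$ and a function $\varphi_h\in D(H)$ with $\|\varphi_h\|_{L^2(]-\infty,0[)}=1$, supported in $[x_+,0[$, such that $$\left\|\left(H-(E^+(h))^{1/2}\right)\varphi_h\right\|_{L^2(]-\infty,0[)}\le e^{-D/h}.$$ -/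

import Mathlib

open MeasureTheory Set
open scoped ContDiff

namespace SAdS

noncomputable section

/-- The metric function `F(r) = 1 - 2M/r + r²/l²` of Schwarzschild-Anti-de Sitter space-time. -/
def F (M l r : ℝ) : ℝ := 1 - 2 * M / r + r ^ 2 / l ^ 2

/-- The radius `r_SAdS = p₊ + p₋` of the horizon, i.e. the real zero of `F`, where
`p_± = (M l² ± √(M² l⁴ + l⁶ / 27))^{1/3}`. The second radicand is negative, so that its real cube
root is minus the cube root of its opposite. -/
def horizon (M l : ℝ) : ℝ :=
  (Real.sqrt (M ^ 2 * l ^ 4 + l ^ 6 / 27) + M * l ^ 2) ^ (1 / 3 : ℝ)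
    - (Real.sqrt (M ^ 2 * l ^ 4 + l ^ 6 / 27) - M * l ^ 2) ^ (1 / 3 : ℝ)

/-- The horizon radius is a zero of `F`, written as a zero of the cubic `l² r F(r)`. -/
theorem horizon_cubic (M l : ℝ) (hM : 0 < M) :
    horizon M l ^ 3 + l ^ 2 * horizon M l - 2 * M * l ^ 2 = 0 := by
  unfold horizon
  set s := Real.sqrt (M ^ 2 * l ^ 4 + l ^ 6 / 27) with hs
  have hs2 : s ^ 2 = M ^ 2 * l ^ 4 + l ^ 6 / 27 := Real.sq_sqrt (by positivity)
  have hs0 : 0 ≤ s := Real.sqrt_nonneg _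
  have hle : M * l ^ 2 ≤ s := by
    apply Real.le_sqrt_of_sq_le
    have : 0 ≤ l ^ 6 / 27 := by positivity
    nlinarith
  have ha : 0 ≤ s + M * l ^ 2 := by positivity
  have hb : 0 ≤ s - M * l ^ 2 := by linarith
  have hp3 : ((s + M * l ^ 2) ^ (1 / 3 : ℝ)) ^ 3 = s + M * l ^ 2 := by
    rw [← Real.rpow_natCast, ← Real.rpow_mul ha]; norm_num
  have hq3 : ((s - M * l ^ 2) ^ (1 / 3 : ℝ)) ^ 3 = s - M * l ^ 2 := by
    rw [← Real.rpow_natCast, ← Real.rpow_mul hb]; norm_num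
  have hpq : (s + M * l ^ 2) ^ (1 / 3 : ℝ) * (s - M * l ^ 2) ^ (1 / 3 : ℝ) = l ^ 2 / 3 := by
    rw [← Real.mul_rpow ha hb]
    have : (s + M * l ^ 2) * (s - M * l ^ 2) = (l ^ 2 / 3) ^ 3 := by
      linear_combination hs2
    rw [this, ← Real.rpow_natCast, ← Real.rpow_mul (by positivity)]
    norm_num
  generalize (s + M * l ^ 2) ^ (1 / 3 : ℝ) = p at *
  generalize (s - M * l ^ 2) ^ (1 / 3 : ℝ) = q at *
  linear_combination hp3 - hq3 - 3 * (p - q) * hpq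

/-- The tortoise coordinate `x(r) = -∫_r^∞ dρ / F(ρ)` for `r > r_SAdS`, that is the solution of
`dx/dr = 1 / F(r)` with `x(r) → 0` as `r → ∞`. -/
def tortoise (M l r : ℝ) : ℝ := -∫ ρ in Ioi r, (F M l ρ)⁻¹

/-- The radius `r ∈ ]r_SAdS, ∞[` as a function of the tortoise coordinate `x ∈ ]-∞, 0[`. -/
def radius (M l : ℝ) : ℝ → ℝ := Function.invFunOn (tortoise M l) (Ioi (horizon M l))

/-- The potential `A(x) = F(r)^{1/2} / r` at `r = r(x)`. -/
def A (M l x : ℝ) : ℝ := Real.sqrt (F M l (radius M l x)) / radius M l x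

/-- The potential `B(x) = F(r)^{1/2}` at `r = r(x)`. -/
def B (M l x : ℝ) : ℝ := Real.sqrt (F M l (radius M l x))

/-- The Dirac matrix `γ⁰`. -/
def γ0 : Matrix (Fin 4) (Fin 4) ℂ :=
  Complex.I • !![0, 0, 1, 0; 0, 0, 0, 1; -1, 0, 0, 0; 0, -1, 0, 0]

/-- The Dirac matrix `γ¹`. -/
def γ1 : Matrix (Fin 4) (Fin 4) ℂ :=
  Complex.I • !![0, 0, 1, 0; 0, 0, 0, -1; 1, 0, 0, 0; 0, -1, 0, 0]

/-- The Dirac matrix `γ²`. -/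
def γ2 : Matrix (Fin 4) (Fin 4) ℂ :=
  Complex.I • !![0, 0, 0, 1; 0, 0, 1, 0; 0, 1, 0, 0; 1, 0, 0, 0]

/-- The space `ℂ⁴` of spinors with its Hermitian norm. -/
abbrev Spinor : Type := EuclideanSpace ℂ (Fin 4)

/-- The Hilbert space `L²(]-∞, 0[; ℂ⁴)`. -/
abbrev L2 : Type := Lp Spinor 2 (volume.restrict (Iio (0 : ℝ)))

/-- The zeroth order part `γ⁰γ² A(x) - h m γ⁰ B(x)` of the Dirac operator. -/
def potential (M l m h x : ℝ) : Matrix (Fin 4) (Fin 4) ℂ :=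
  (A M l x : ℂ) • (γ0 * γ2) - ((h * m * B M l x : ℝ) : ℂ) • γ0

/-- `ψ = H φ` on `]-∞, 0[` in the sense of distributions, where
`H = i γ⁰γ¹ h ∂ₓ + γ⁰γ² A(x) - h m γ⁰ B(x)`: the derivative is moved to the scalar test
functions `η ∈ C_c^∞(]-∞, 0[)`. -/
def IsDiracImage (M l m h : ℝ) (φ ψ : L2) : Prop :=
  ∀ η : ℝ → ℝ, ContDiff ℝ ∞ η → HasCompactSupport η → tsupport η ⊆ Iio 0 →
    ∫ x in Iio (0 : ℝ), η x • ψ x =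
      ∫ x in Iio (0 : ℝ),
        ((-deriv η x) • Matrix.toEuclideanLin ((Complex.I * (h : ℂ)) • (γ0 * γ1)) (φ x)
          + η x • Matrix.toEuclideanLin (potential M l m h x) (φ x))

/-- The distribution `H φ` is represented by at most one element of `L²`. -/
theorem IsDiracImage.unique {M l m h : ℝ} {φ ψ₁ ψ₂ : L2}
    (h₁ : IsDiracImage M l m h φ ψ₁) (h₂ : IsDiracImage M l m h φ ψ₂) : ψ₁ = ψ₂ := by
  have hloc : ∀ ψ : L2, LocallyIntegrableOn (fun x => ψ x) (Iio (0 : ℝ)) volume := fun ψ =>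
    locallyIntegrableOn_of_locallyIntegrable_restrict
      ((Lp.memLp ψ).locallyIntegrable (by norm_num))
  have key := isOpen_Iio.ae_eq_zero_of_integral_contDiff_smul_eq_zero (μ := volume)
    (f := fun x => ψ₁ x - ψ₂ x) (U := Iio (0 : ℝ)) ((hloc ψ₁).sub (hloc ψ₂)) (by
      intro η hη hc hsub
      have hint : ∀ ψ : L2, IntegrableOn (fun x => η x • ψ x) (Iio 0) volume := fun ψ =>
        ((Lp.memLp ψ).locallyIntegrable (by norm_num)).integrable_smul_left_of_hasCompactSupport
          hη.continuous hc
      have e : ∫ x in Iio (0 : ℝ), η x • (ψ₁ x - ψ₂ x) = 0 := by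
        simp only [smul_sub]
        rw [integral_sub (hint ψ₁) (hint ψ₂), h₁ η hη hc hsub, h₂ η hη hc hsub, sub_self]
      rw [← e, setIntegral_eq_integral_of_forall_compl_eq_zero]
      intro x hx
      rw [image_eq_zero_of_notMem_tsupport (fun hx' => hx (hsub hx')), zero_smul])
  apply Lp.ext
  rw [Filter.EventuallyEq, ae_restrict_iff' measurableSet_Iio]
  filter_upwards [key] with x hx hx0
  exact sub_eq_zero.mp (hx hx0)

/-- The natural domain `D(H) = {φ ∈ L² | H φ ∈ L²}`. -/
def domain (M l m h : ℝ) : Set L2 := {φ | ∃ ψ, IsDiracImage M l m h φ ψ}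

open Classical in
/-- The semiclassical radial Dirac operator `H` on `D(H)` (with value `0` outside `D(H)`). -/
def dirac (M l m h : ℝ) (φ : L2) : L2 :=
  if hφ : ∃ ψ, IsDiracImage M l m h φ ψ then hφ.choose else 0

/-- On its domain, `H` is computed by the distributional expression. -/
theorem dirac_eq {M l m h : ℝ} {φ ψ : L2} (hφ : IsDiracImage M l m h φ ψ) :
    dirac M l m h φ = ψ := by
  have hex : ∃ ψ, IsDiracImage M l m h φ ψ := ⟨ψ, hφ⟩
  rw [dirac, dif_pos hex]
  exact hex.choose_spec.unique hφ

end

end SAdS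

/-! The operator preserves a real two-dimensional family of spinors with coordinates `(u, v)`. With
`y = -x` and an increasing weight `s` solving `s' = m β s`, the substitution `u = s w`, `v = s b`
removes the mass term and turns the eigenvalue equation into `h w' = -(lam + α) b`, `h (a b)' = (lam
- α) a w`, where `a = s ^ 2` and `α` is the potential `A`. The weight may vanish at `y = 0`, which
corresponds to infinity in `r`. A Volterra fixed point (`exists_volterra_solution`) still gives the
solution with `w = 1` and `a b = 0` there, jointly continuous in the spectral parameter and in `y`.

The condition on `r₊` forces `r₊ ≥ 4 M`. There `A² = 1/l² + r⁻² - 2 M r⁻³` increases with `y`, from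
`1/l²` at the boundary. So `α` is a well at `y = 0` followed by a barrier of height above `lam1`
near the end `Y = -x₊`.

A suitable energy is found by shooting rather than by spectral theory. At `lam = α 0` the function
`w` stays positive; at `lam1`, for small `h`, the rotation of the angle `arctan (a b / w)` makes it
nonpositive somewhere. At the smallest parameter for which `w` fails to stay positive on `[0, Y]`,
both `w` and `z = a b` are nonnegative (`exists_nonneg_solution`). Then `P = w z` is nonnegative and
satisfies `P' ≤ -(δ / h) Q` in the barrier, `Q = a (w² + b²)` being the density. As `2 P ≤ Q`, this
yields exponential decay with no separate Agmon estimate (`integral_density_le`).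

Cutting the solution off near `Y` leaves only the commutator with the cutoff as a defect, and that
lives where the density is exponentially small (`exists_truncated`, `exists_quasimode`). The energy
is `E = lam ^ 2`. -/

namespace SAdS

open Filter Topology BoundedContinuousFunction

/-! ### Regular solutions at the singular endpoint, by a Volterra fixed point -/

/-- The weighted Volterra operator with kernel `p(l,t) a(t) / a(s)`, conjugated by `exp (k s)`. -/
noncomputable def volterra (p : ℝ × ℝ → ℝ) (a : ℝ → ℝ) (k : ℝ) (f : ℝ × ℝ → ℝ) (x : ℝ × ℝ) : ℝ :=
  Real.exp (-(k * x.2)) / a x.2 *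
    ∫ t in (0 : ℝ)..max x.2 0, p (x.1, t) * a t * Real.exp (k * t) * f (x.1, t)

theorem volterra_of_nonpos (p : ℝ × ℝ → ℝ) (a : ℝ → ℝ) (k : ℝ) (f : ℝ × ℝ → ℝ) {x : ℝ × ℝ}
    (hx : x.2 ≤ 0) : volterra p a k f x = 0 := by
  simp [volterra, max_eq_right hx]

theorem volterra_integrand_le {p : ℝ × ℝ → ℝ} {C : ℝ} (hpC : ∀ x, |p x| ≤ C) {a : ℝ → ℝ}
    (ham : Monotone a) (hpos : ∀ y, 0 < y → 0 < a y) (k : ℝ) (f : ℝ × ℝ →ᵇ ℝ) {l s t : ℝ}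
    (ht : 0 < t) (hts : t ≤ s) :
    |p (l, t) * a t * Real.exp (k * t) * f (l, t)| ≤ C * a s * ‖f‖ * Real.exp (k * t) := by
  have hC : 0 ≤ C := (abs_nonneg _).trans (hpC (0, 0))
  have h1 : |f (l, t)| ≤ ‖f‖ := f.norm_coe_le_norm (l, t)
  rw [abs_mul, abs_mul, abs_mul, abs_of_pos (hpos t ht), abs_of_pos (Real.exp_pos _)]
  calc |p (l, t)| * a t * Real.exp (k * t) * |f (l, t)|
      ≤ C * a s * Real.exp (k * t) * ‖f‖ := by
        have := hpC (l, t)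
        have := ham hts
        have := (hpos t ht).le
        have := (hpos s (ht.trans_le hts)).le
        gcongr
    _ = _ := by ring

/-- Monotonicity of `a` bounds the singular quotient `a t / a s` by `1`, and the exponential
conjugation supplies the factor `1 / k`. Large `k` therefore gives a contraction on the whole
half-line, without subdividing it. -/
theorem abs_volterra_le {p : ℝ × ℝ → ℝ} {C : ℝ} (hpC : ∀ x, |p x| ≤ C)
    {a : ℝ → ℝ} (ham : Monotone a) (hpos : ∀ y, 0 < y → 0 < a y) {k : ℝ} (hk : 0 < k)
    (f : ℝ × ℝ →ᵇ ℝ) (x : ℝ × ℝ) : |volterra p a k f x| ≤ C / k * ‖f‖ := by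
  have hC : 0 ≤ C := (abs_nonneg _).trans (hpC (0, 0))
  rcases le_or_gt x.2 0 with hx | hx
  · rw [volterra_of_nonpos _ _ _ _ hx, abs_zero]; positivity
  · obtain ⟨l, s⟩ := x
    simp only at hx
    have has := hpos s hx
    have hder : ∀ t ∈ uIcc 0 s, HasDerivAt (fun t => C * a s * ‖f‖ * (Real.exp (k * t) / k))
        (C * a s * ‖f‖ * Real.exp (k * t)) t := by
      intro t _
      have h1 : HasDerivAt (fun t => Real.exp (k * t)) (Real.exp (k * t) * (k * 1)) t :=
        ((hasDerivAt_id t).const_mul k).exp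
      have h2 := (h1.div_const k).const_mul (C * a s * ‖f‖)
      have h3 : Real.exp (k * t) * (k * 1) / k = Real.exp (k * t) := by field_simp
      rw [h3] at h2
      exact h2
    have hint : IntervalIntegrable (fun t => C * a s * ‖f‖ * Real.exp (k * t)) volume 0 s :=
      Continuous.intervalIntegrable (by fun_prop) _ _
    have hb := intervalIntegral.norm_integral_le_of_norm_le (μ := volume) hx.le
      (f := fun t => p (l, t) * a t * Real.exp (k * t) * f (l, t))
      (g := fun t => C * a s * ‖f‖ * Real.exp (k * t))
      (Eventually.of_forall fun t ht => volterra_integrand_le hpC ham hpos k f ht.1 ht.2) hint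
    rw [intervalIntegral.integral_eq_sub_of_hasDerivAt hder hint, Real.norm_eq_abs] at hb
    simp only [volterra, max_eq_left hx.le]
    rw [abs_mul, abs_of_pos (by positivity)]
    calc _ ≤ Real.exp (-(k * s)) / a s * (C * a s * ‖f‖ * (Real.exp (k * s) / k)) := by
          gcongr
          refine hb.trans ?_
          have : 0 ≤ C * a s * ‖f‖ * (Real.exp (k * 0) / k) := by positivity
          linarith
      _ = C / k * ‖f‖ := by
          rw [Real.exp_neg]; field_simp

/-- The quotient `a t / a s` is at most `1`, so the length of the interval remains as a factor. This
gives continuity at `y = 0`, where the prefactor `1 / a` may blow up. -/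
theorem abs_volterra_le_mul {p : ℝ × ℝ → ℝ} {C : ℝ} (hpC : ∀ x, |p x| ≤ C)
    {a : ℝ → ℝ} (ham : Monotone a) (hpos : ∀ y, 0 < y → 0 < a y) {k : ℝ} (hk : 0 < k)
    (f : ℝ × ℝ →ᵇ ℝ) (x : ℝ × ℝ) : |volterra p a k f x| ≤ C * ‖f‖ * max x.2 0 := by
  have hC : 0 ≤ C := (abs_nonneg _).trans (hpC (0, 0))
  rcases le_or_gt x.2 0 with hx | hx
  · rw [volterra_of_nonpos _ _ _ _ hx, abs_zero]; positivity
  · obtain ⟨l, s⟩ := x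
    simp only at hx
    have has := hpos s hx
    have hb := intervalIntegral.norm_integral_le_of_norm_le_const (a := 0) (b := s)
      (f := fun t => p (l, t) * a t * Real.exp (k * t) * f (l, t))
      (C := C * a s * ‖f‖ * Real.exp (k * s)) (by
        intro t ht
        rw [uIoc_of_le hx.le] at ht
        refine (volterra_integrand_le hpC ham hpos k f ht.1 ht.2).trans ?_
        have := ht.2
        gcongr)
    rw [Real.norm_eq_abs, sub_zero, abs_of_pos hx] at hb
    simp only [volterra, max_eq_left hx.le]
    rw [abs_mul, abs_of_pos (by positivity)]
    calc _ ≤ Real.exp (-(k * s)) / a s * (C * a s * ‖f‖ * Real.exp (k * s) * s) := by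
          gcongr
      _ = C * ‖f‖ * s := by
          rw [Real.exp_neg]; field_simp

theorem continuous_volterra {p : ℝ × ℝ → ℝ} (hp : Continuous p) {C : ℝ} (hpC : ∀ x, |p x| ≤ C)
    {a : ℝ → ℝ} (ha : Continuous a) (ham : Monotone a) (hpos : ∀ y, 0 < y → 0 < a y)
    {k : ℝ} (hk : 0 < k) (f : ℝ × ℝ →ᵇ ℝ) : Continuous (volterra p a k f) := by
  rw [continuous_iff_continuousAt]
  intro x
  rcases le_or_gt x.2 0 with hx | hx
  · rw [ContinuousAt, volterra_of_nonpos _ _ _ _ hx]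
    refine squeeze_zero_norm (fun y => abs_volterra_le_mul hpC ham hpos hk f y) ?_
    have : Continuous fun y : ℝ × ℝ => C * ‖f‖ * max y.2 0 := by fun_prop
    have h := this.tendsto x
    simpa [max_eq_right hx] using h
  · have h1 : Continuous fun x : ℝ × ℝ =>
        ∫ t in (0 : ℝ)..max x.2 0, p (x.1, t) * a t * Real.exp (k * t) * f (x.1, t) := by
      apply intervalIntegral.continuous_parametric_intervalIntegral_of_continuous
      · simp only [Function.uncurry_def]
        have := f.continuous
        fun_prop
      · fun_prop
    have h2 : ContinuousAt (fun x : ℝ × ℝ => Real.exp (-(k * x.2)) / a x.2) x := by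
      apply ContinuousAt.div
      · fun_prop
      · fun_prop
      · exact (hpos _ hx).ne'
    exact h2.mul h1.continuousAt

/-- The Volterra operator on bounded continuous functions. -/
noncomputable def volterraBCF {p : ℝ × ℝ → ℝ} (hp : Continuous p) {C : ℝ} (hpC : ∀ x, |p x| ≤ C)
    {a : ℝ → ℝ} (ha : Continuous a) (ham : Monotone a) (hpos : ∀ y, 0 < y → 0 < a y)
    {k : ℝ} (hk : 0 < k) (f : ℝ × ℝ →ᵇ ℝ) : ℝ × ℝ →ᵇ ℝ :=
  ofNormedAddCommGroup (volterra p a k f) (continuous_volterra hp hpC ha ham hpos hk f)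
    (C / k * ‖f‖) (abs_volterra_le hpC ham hpos hk f)

theorem volterra_sub {p : ℝ × ℝ → ℝ} (hp : Continuous p) {a : ℝ → ℝ} (ha : Continuous a) (k : ℝ)
    (f g : ℝ × ℝ →ᵇ ℝ) (x : ℝ × ℝ) :
    volterra p a k f x - volterra p a k g x = volterra p a k ⇑(f - g) x := by
  have hf := f.continuous
  have hg := g.continuous
  have hi : ∀ f : ℝ × ℝ →ᵇ ℝ, IntervalIntegrable
      (fun t => p (x.1, t) * a t * Real.exp (k * t) * f (x.1, t)) volume 0 (max x.2 0) := by
    intro f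
    have hf := f.continuous
    exact Continuous.intervalIntegrable (by fun_prop) _ _
  simp only [volterra]
  rw [← mul_sub, ← intervalIntegral.integral_sub (hi f) (hi g)]
  congr 2
  ext t
  simp only [coe_sub, Pi.sub_apply]
  ring

theorem norm_volterraBCF_sub_le {p : ℝ × ℝ → ℝ} (hp : Continuous p) {C : ℝ}
    (hpC : ∀ x, |p x| ≤ C) {a : ℝ → ℝ} (ha : Continuous a) (ham : Monotone a)
    (hpos : ∀ y, 0 < y → 0 < a y) {k : ℝ} (hk : 0 < k) (f g : ℝ × ℝ →ᵇ ℝ) :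
    ‖volterraBCF hp hpC ha ham hpos hk f - volterraBCF hp hpC ha ham hpos hk g‖
      ≤ C / k * ‖f - g‖ := by
  have hC : 0 ≤ C := (abs_nonneg _).trans (hpC (0, 0))
  refine (norm_le (by positivity)).2 fun x => ?_
  change |volterra p a k f x - volterra p a k g x| ≤ _
  rw [volterra_sub hp ha]
  exact abs_volterra_le hpC ham hpos hk (f - g) x

/-- Solutions of the singular system `w' = -q z / a`, `z' = p a w` with `w = 1`, `z = 0` at `0`,
jointly continuous in the parameter and the variable; `b = z / a`. -/
theorem exists_volterra_solution {p q : ℝ × ℝ → ℝ} (hp : Continuous p) (hq : Continuous q)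
    {C : ℝ} (hpC : ∀ x, |p x| ≤ C) (hqC : ∀ x, |q x| ≤ C)
    {a : ℝ → ℝ} (ha : Continuous a) (ham : Monotone a) (hpos : ∀ y, 0 < y → 0 < a y) :
    ∃ w b : ℝ × ℝ → ℝ, Continuous w ∧ Continuous b ∧
      (∀ l y, 0 ≤ y → w (l, y) = 1 - ∫ t in (0 : ℝ)..y, q (l, t) * b (l, t)) ∧
      (∀ l y, 0 ≤ y → a y * b (l, y) = ∫ t in (0 : ℝ)..y, p (l, t) * a t * w (l, t)) := by
  have hC : 0 ≤ C := (abs_nonneg _).trans (hpC (0, 0))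
  set k : ℝ := 2 * (C + 1) with hkdef
  have hk : 0 < k := by positivity
  have hCk : C / k ≤ 1 / 2 := by
    rw [div_le_div_iff₀ hk (by norm_num)]; rw [hkdef]; linarith
  set Jp := volterraBCF hp hpC ha ham hpos hk with hJp
  set Jq := volterraBCF hq hqC (a := fun _ => 1) continuous_const monotone_const
    (fun _ _ => one_pos) hk with hJq
  -- The constant `1`, that is the initial value of `w`, after conjugation by the exponential
  -- weight.
  set e : ℝ × ℝ →ᵇ ℝ := ofNormedAddCommGroup (fun x : ℝ × ℝ => Real.exp (-(k * max x.2 0)))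
    (by fun_prop) 1 (by
      intro x
      rw [Real.norm_eq_abs, abs_of_pos (Real.exp_pos _), Real.exp_le_one_iff]
      have : 0 ≤ k * max x.2 0 := by positivity
      linarith) with he
  set T : (ℝ × ℝ →ᵇ ℝ) → (ℝ × ℝ →ᵇ ℝ) := fun f => e - Jq (Jp f) with hT
  have hcon : ContractingWith (1 / 2) T := by
    refine ⟨by
      rw [← NNReal.coe_lt_coe]; norm_num, LipschitzWith.of_dist_le_mul fun f g => ?_⟩
    rw [dist_eq_norm, dist_eq_norm]
    have h1 : T f - T g = -(Jq (Jp f) - Jq (Jp g)) := by simp only [hT]; abel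
    rw [h1, norm_neg]
    have h2 := norm_volterraBCF_sub_le hq hqC (a := fun _ => 1) continuous_const monotone_const
      (fun _ _ => one_pos) hk (Jp f) (Jp g)
    have h3 := norm_volterraBCF_sub_le hp hpC ha ham hpos hk f g
    have h4 : (0 : ℝ) ≤ C / k := by positivity
    push_cast
    calc _ ≤ C / k * (C / k * ‖f - g‖) := h2.trans (mul_le_mul_of_nonneg_left h3 h4)
      _ ≤ 1 * (1 / 2 * ‖f - g‖) := by gcongr; linarith
      _ = _ := by ring
  set o := hcon.fixedPoint T with ho
  have hfix : T o = o := hcon.fixedPoint_isFixedPt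
  have hoc := o.continuous
  have hJc := (Jp o).continuous
  -- The conjugation is undone: `o` is the damped `w`, and `Jp o` the damped `b = z / a`.
  refine ⟨fun x => Real.exp (k * x.2) * o x, fun x => Real.exp (k * x.2) * Jp o x, by fun_prop,
    by fun_prop, ?_, ?_⟩
  · intro l y hy
    have h1 : o (l, y) = Real.exp (-(k * max y 0)) -
        volterra q (fun _ => 1) k (Jp o) (l, y) := by
      conv_lhs => rw [← hfix]
      rfl
    simp only [h1, volterra, max_eq_left hy, mul_sub]
    have h2 : Real.exp (k * y) * Real.exp (-(k * y)) = 1 := by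
      rw [← Real.exp_add]; simp
    rw [h2, div_one, ← mul_assoc, h2, one_mul]
    simp only [mul_one, mul_assoc]
  · intro l y hy
    change a y * (Real.exp (k * y) * volterra p a k o (l, y)) = _
    rcases hy.eq_or_lt with rfl | hy0
    · simp [volterra]
    · have h2 : Real.exp (k * y) * Real.exp (-(k * y)) = 1 := by
        rw [← Real.exp_add]; simp
      have h3 := (hpos y hy0).ne'
      simp only [volterra, max_eq_left hy]
      calc _ = (Real.exp (k * y) * Real.exp (-(k * y))) * (a y / a y) *
            ∫ t in (0 : ℝ)..y, p (l, t) * a t * Real.exp (k * t) * o (l, t) := by ring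
        _ = _ := by
          rw [h2, div_self h3, one_mul, one_mul]
          simp only [mul_assoc]

/-! ### Sign of the regular solution and the shooting argument -/

theorem monotoneOn_Icc_of_hasDerivAt {f f' : ℝ → ℝ} {c d : ℝ} (hc : ContinuousOn f (Icc c d))
    (hd : ∀ x ∈ Ioo c d, HasDerivAt f (f' x) x) (hs : ∀ x ∈ Ioo c d, 0 ≤ f' x) :
    MonotoneOn f (Icc c d) := by
  refine monotoneOn_of_hasDerivWithinAt_nonneg (f' := f') (convex_Icc c d) hc ?_ ?_
  · intro x hx
    rw [interior_Icc] at hx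
    exact (hd x hx).hasDerivWithinAt
  · intro x hx
    rw [interior_Icc] at hx
    exact hs x hx

theorem antitoneOn_Icc_of_hasDerivAt {f f' : ℝ → ℝ} {c d : ℝ} (hc : ContinuousOn f (Icc c d))
    (hd : ∀ x ∈ Ioo c d, HasDerivAt f (f' x) x) (hs : ∀ x ∈ Ioo c d, f' x ≤ 0) :
    AntitoneOn f (Icc c d) := by
  have h := monotoneOn_Icc_of_hasDerivAt (f := fun x => -f x) (f' := fun x => -f' x) hc.neg
    (fun x hx => (hd x hx).neg) (fun x hx => neg_nonneg.2 (hs x hx))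
  intro x hx y hy hxy
  exact neg_le_neg_iff.1 (h hx hy hxy)

/-- The regular solution at `0` of `h w' = -(lam + α) b`, `h (a b)' = (lam - α) a w`. -/
structure IsRegularSolution (α a : ℝ → ℝ) (h lam : ℝ) (w b : ℝ → ℝ) : Prop where
  continuous_w : Continuous w
  continuous_b : Continuous b
  w_eq : ∀ y, 0 ≤ y → w y = 1 - ∫ t in (0 : ℝ)..y, (lam + α t) / h * b t
  b_eq : ∀ y, 0 ≤ y → a y * b y = ∫ t in (0 : ℝ)..y, (lam - α t) / h * a t * w t

/-- A potential `α` increasing on `[0, Y]` from a positive value, and a weight `a`. -/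
structure IsRadialData (α a : ℝ → ℝ) (Y : ℝ) : Prop where
  continuous_α : Continuous α
  monotone_α : MonotoneOn α (Icc 0 Y)
  bounded_α : ∃ C, ∀ y, |α y| ≤ C
  α_pos : 0 < α 0
  continuous_a : Continuous a
  monotone_a : Monotone a
  a_pos : ∀ y, 0 < y → 0 < a y
  Y_pos : 0 < Y

namespace IsRegularSolution

variable {α a : ℝ → ℝ} {Y h lam : ℝ} {w b : ℝ → ℝ}

theorem w_zero (hS : IsRegularSolution α a h lam w b) : w 0 = 1 := by
  simpa using hS.w_eq 0 le_rfl

theorem hasDerivAt_w (hS : IsRegularSolution α a h lam w b) (hα : Continuous α) {y : ℝ}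
    (hy : 0 < y) : HasDerivAt w (-((lam + α y) / h * b y)) y := by
  have hb := hS.continuous_b
  have hc : Continuous fun t => (lam + α t) / h * b t := by fun_prop
  have h1 := (hc.integral_hasStrictDerivAt 0 y).hasDerivAt.const_sub 1
  refine h1.congr_of_eventuallyEq ?_
  filter_upwards [lt_mem_nhds hy] with t ht
  exact hS.w_eq t ht.le

theorem hasDerivAt_z (hS : IsRegularSolution α a h lam w b) (hα : Continuous α)
    (ha : Continuous a) {y : ℝ} (hy : 0 < y) :
    HasDerivAt (fun t => a t * b t) ((lam - α y) / h * a y * w y) y := by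
  have hw := hS.continuous_w
  have hc : Continuous fun t => (lam - α t) / h * a t * w t := by fun_prop
  have h1 := (hc.integral_hasStrictDerivAt 0 y).hasDerivAt
  refine h1.congr_of_eventuallyEq ?_
  filter_upwards [lt_mem_nhds hy] with t ht
  exact hS.b_eq t ht.le

theorem z_zero (hS : IsRegularSolution α a h lam w b) : a 0 * b 0 = 0 := by
  simpa using hS.b_eq 0 le_rfl

theorem continuous_z (hS : IsRegularSolution α a h lam w b) (ha : Continuous a) :
    Continuous fun t => a t * b t := ha.mul hS.continuous_b

end IsRegularSolution

namespace IsRadialData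

variable {α a : ℝ → ℝ} {Y h lam : ℝ} {w b : ℝ → ℝ}

theorem α_le (hD : IsRadialData α a Y) {y : ℝ} (hy : y ∈ Icc 0 Y) : α 0 ≤ α y :=
  hD.monotone_α ⟨le_rfl, hD.Y_pos.le⟩ hy hy.1

/-- As `α` increases, `lam - α` is nonnegative on all of `[0, y]`, so `z = a b` grows from `0` as
long as `w` is nonnegative. -/
theorem z_nonneg_of_le (hD : IsRadialData α a Y) (hS : IsRegularSolution α a h lam w b)
    (hh : 0 < h) {y : ℝ} (hy : y ∈ Icc 0 Y) (hle : α y ≤ lam) (hw : ∀ t ∈ Icc 0 y, 0 ≤ w t) :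
    0 ≤ a y * b y := by
  have hm := monotoneOn_Icc_of_hasDerivAt (c := 0) (d := y)
    (hS.continuous_z hD.continuous_a).continuousOn
    (fun x hx => hS.hasDerivAt_z hD.continuous_α hD.continuous_a hx.1) (by
      intro x hx
      have h1 := hw x ⟨hx.1.le, hx.2.le⟩
      have h2 := (hD.a_pos x hx.1).le
      have h3 : α x ≤ α y := hD.monotone_α ⟨hx.1.le, hx.2.le.trans hy.2⟩ hy hx.2.le
      have h4 : 0 ≤ lam - α x := by linarith
      positivity)
  have := hm ⟨le_rfl, hy.1⟩ ⟨hy.1, le_rfl⟩ hy.1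
  simpa [hS.z_zero] using this

/-- At the bottom of the well `lam - α ≤ 0`. Before a first zero of `w` the quantity `z` could only
decrease from `0`, making `b ≤ 0` and `w` nondecreasing from `1`, which excludes the zero. -/
theorem w_pos_of_bottom (hD : IsRadialData α a Y) (hS : IsRegularSolution α a h (α 0) w b)
    (hh : 0 < h) {y : ℝ} (hy : y ∈ Icc 0 Y) : 0 < w y := by
  by_contra hcon
  have hcl : IsCompact (Icc 0 Y ∩ {y | w y ≤ 0}) :=
    isCompact_Icc.inter_right (isClosed_le hS.continuous_w continuous_const)
  obtain ⟨c, hc, hmin⟩ := hcl.exists_isLeast ⟨y, hy, not_lt.1 hcon⟩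
  have hpos : ∀ t ∈ Ico 0 c, 0 < w t := by
    intro t ht
    by_contra h1
    exact absurd (hmin ⟨⟨ht.1, ht.2.le.trans hc.1.2⟩, not_lt.1 h1⟩) (not_le.2 ht.2)
  have hanti := antitoneOn_Icc_of_hasDerivAt (c := 0) (d := c)
    (hS.continuous_z hD.continuous_a).continuousOn
    (fun x hx => hS.hasDerivAt_z hD.continuous_α hD.continuous_a hx.1) (by
      intro x hx
      have h1 := (hpos x ⟨hx.1.le, hx.2⟩).le
      have h2 := (hD.a_pos x hx.1).le
      have h3 := hD.α_le ⟨hx.1.le, hx.2.le.trans hc.1.2⟩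
      have h4 : (α 0 - α x) / h ≤ 0 := div_nonpos_of_nonpos_of_nonneg (by linarith) hh.le
      exact mul_nonpos_of_nonpos_of_nonneg (mul_nonpos_of_nonpos_of_nonneg h4 h2) h1)
  have hmono := monotoneOn_Icc_of_hasDerivAt (c := 0) (d := c) hS.continuous_w.continuousOn
    (fun x hx => hS.hasDerivAt_w hD.continuous_α hx.1) (by
      intro x hx
      have h1 := hanti ⟨le_rfl, hc.1.1⟩ ⟨hx.1.le, hx.2.le⟩ hx.1.le
      simp only [hS.z_zero] at h1
      have h2 : b x ≤ 0 := by
        have := hD.a_pos x hx.1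
        by_contra hb
        have : 0 < a x * b x := mul_pos this (not_le.1 hb)
        linarith
      have h3 := hD.α_le ⟨hx.1.le, hx.2.le.trans hc.1.2⟩
      have h4 := hD.α_pos
      have h5 : 0 ≤ (α 0 + α x) / h := div_nonneg (by linarith) hh.le
      have := mul_nonpos_of_nonneg_of_nonpos h5 h2
      linarith)
  have := hmono ⟨le_rfl, hc.1.1⟩ ⟨hc.1.1, le_rfl⟩ hc.1.1
  rw [hS.w_zero] at this
  have h2 : w c ≤ 0 := hc.2
  linarith

/-- Oscillation: for small `h`, the solution cannot stay positive on an interval where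
`α < lam`. -/
theorem exists_nonpos (hD : IsRadialData α a Y) (hS : IsRegularSolution α a h lam w b)
    (hh : 0 < h) {c d k : ℝ} (hc : 0 < c) (hcd : c < d) (hdY : d ≤ Y) (hk : 0 < k)
    (hk1 : k ≤ (lam - α d) * a c) (hk2 : k ≤ lam / a d) (hhk : h < k * (d - c) / 2) :
    ∃ y ∈ Icc 0 Y, w y ≤ 0 := by
  by_contra! hcon
  have hlam : α d < lam := by
    have := hD.a_pos c hc
    by_contra! h1
    have : (lam - α d) * a c ≤ 0 := mul_nonpos_of_nonpos_of_nonneg (by linarith) this.le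
    linarith
  have hw : ∀ t ∈ Icc c d, 0 < w t := fun t ht => hcon t ⟨hc.le.trans ht.1, ht.2.trans hdY⟩
  have hz : ∀ t ∈ Icc c d, 0 ≤ a t * b t := by
    intro t ht
    have h0 := hc.trans_le ht.1
    refine hD.z_nonneg_of_le hS hh ⟨h0.le, ht.2.trans hdY⟩ ?_ ?_
    · exact (hD.monotone_α ⟨h0.le, ht.2.trans hdY⟩ ⟨by linarith, hdY⟩ ht.2).trans hlam.le
    · intro s hs
      exact (hcon s ⟨hs.1, hs.2.trans (ht.2.trans hdY)⟩).le
  -- Prüfer angle of `(w, z)` minus its guaranteed rotation. The choice of `k` bounds both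
  -- coefficients of the angular velocity from below by `k / h`.
  set f : ℝ → ℝ := fun t => Real.arctan (a t * b t / w t) - k / h * t with hf
  have hder : ∀ t ∈ Icc c d, HasDerivAt f (1 / (1 + (a t * b t / w t) ^ 2) *
      (((lam - α t) / h * a t * w t * w t - a t * b t * (-((lam + α t) / h * b t))) / w t ^ 2)
        - k / h * 1) t := by
    intro t ht
    have h0 := hc.trans_le ht.1
    have h1 := (hS.hasDerivAt_z hD.continuous_α hD.continuous_a h0).fun_div
      (hS.hasDerivAt_w hD.continuous_α h0) (hw t ht).ne'
    exact h1.arctan.sub ((hasDerivAt_id t).const_mul _)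
  have hmono := monotoneOn_Icc_of_hasDerivAt (c := c) (d := d)
    (fun t ht => (hder t ht).continuousAt.continuousWithinAt)
    (fun t ht => hder t ⟨ht.1.le, ht.2.le⟩) (by
      intro t ht'
      have ht : t ∈ Icc c d := ⟨ht'.1.le, ht'.2.le⟩
      have h0 := hc.trans_le ht.1
      have hwt := hw t ht
      have hat := hD.a_pos t h0
      have hαt : α t ≤ α d :=
        hD.monotone_α ⟨h0.le, ht.2.trans hdY⟩ ⟨by linarith, hdY⟩ ht.2
      have hα0 := hD.α_le ⟨h0.le, ht.2.trans hdY⟩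
      have hα1 := hD.α_pos
      have hac : a c ≤ a t := hD.monotone_a ht.1
      have had : a t ≤ a d := hD.monotone_a ht.2
      have hac0 := hD.a_pos c hc
      have e1 : k ≤ (lam - α t) * a t :=
        hk1.trans (mul_le_mul (by linarith) hac hac0.le (by linarith))
      have e2 : k ≤ (lam + α t) / a t := by
        refine hk2.trans ?_
        have : 0 < lam := by linarith
        apply div_le_div₀ <;> linarith
      have e3 : k * (a t * b t) ^ 2 ≤ (lam + α t) * a t * b t ^ 2 := by
        have := mul_le_mul_of_nonneg_right e2 (sq_nonneg (a t * b t))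
        calc _ ≤ _ := this
          _ = _ := by field_simp
      have e4 : k * w t ^ 2 ≤ (lam - α t) * a t * w t ^ 2 :=
        mul_le_mul_of_nonneg_right e1 (sq_nonneg _)
      have hsum : 0 < w t ^ 2 + (a t * b t) ^ 2 := by positivity
      have e5 : 1 / (1 + (a t * b t / w t) ^ 2) *
          (((lam - α t) / h * a t * w t * w t - a t * b t * (-((lam + α t) / h * b t))) / w t ^ 2)
          = ((lam - α t) * a t * w t ^ 2 + (lam + α t) * a t * b t ^ 2) /
            (h * (w t ^ 2 + (a t * b t) ^ 2)) := by
        field_simp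
        ring
      rw [e5, mul_one, sub_nonneg, div_le_div_iff₀ hh (by positivity)]
      have := mul_le_mul_of_nonneg_right (add_le_add e4 e3) hh.le
      linarith)
  have hfin := hmono ⟨le_rfl, hcd.le⟩ ⟨hcd.le, le_rfl⟩ hcd.le
  simp only [hf] at hfin
  have h1 := Real.arctan_lt_pi_div_two (a d * b d / w d)
  have h2 : 0 ≤ Real.arctan (a c * b c / w c) :=
    Real.arctan_nonneg.2 (div_nonneg (hz c ⟨le_rfl, hcd.le⟩) (hw c ⟨le_rfl, hcd.le⟩).le)
  have h3 := Real.pi_le_four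
  -- The angle would have to gain more than `2 ≥ π / 2`, while positivity of `w` and nonnegativity
  -- of `z` confine it to `[0, π / 2)`.
  have h4 : 2 < k / h * (d - c) := by
    rw [div_mul_eq_mul_div, lt_div_iff₀ hh]; linarith
  linarith

/-- A regular solution does not vanish together with its conjugate variable. -/
theorem not_both_zero (hD : IsRadialData α a Y) (hS : IsRegularSolution α a h lam w b)
    {y : ℝ} (hy : 0 < y) (hw : w y = 0) (hb : b y = 0) : False := by
  have hα := hD.continuous_α
  have ha := hD.continuous_a
  have key : ∀ c ∈ Ioo 0 y, w c = 0 := by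
    intro c hc
    have hpos : ∀ t ∈ Icc c y, 0 < a t := fun t ht => hD.a_pos t (hc.1.trans_le ht.1)
    -- The coefficient with `1 / a` may be unbounded at `0`, so the Grönwall constant is taken on
    -- `[c, y]` only. Continuity of `w` at `0` finishes the argument.
    have hcK : ContinuousOn (fun t => |(lam + α t) / h / a t| + |(lam - α t) / h * a t|)
        (Icc c y) := by
      refine ContinuousOn.add (ContinuousOn.abs (ContinuousOn.div (by fun_prop) (by fun_prop)
        fun t ht => (hpos t ht).ne')) (by fun_prop)
    obtain ⟨K, hK⟩ := isCompact_Icc.exists_bound_of_continuousOn hcK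
    set E : ℝ → ℝ := fun t => (w t ^ 2 + (a t * b t) ^ 2) * Real.exp (K * t) with hE
    have hder : ∀ t ∈ Icc c y, HasDerivAt E
        ((2 * w t * (-((lam + α t) / h * b t)) +
          2 * (a t * b t) * ((lam - α t) / h * a t * w t)) * Real.exp (K * t) +
          (w t ^ 2 + (a t * b t) ^ 2) * (Real.exp (K * t) * (K * 1))) t := by
      intro t ht
      have h0 := hc.1.trans_le ht.1
      have h1 := (hS.hasDerivAt_w hα h0).fun_pow 2
      have h2 := (hS.hasDerivAt_z hα ha h0).fun_pow 2
      have h3 := (h1.add h2).mul ((hasDerivAt_id t).const_mul K).exp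
      refine h3.congr_deriv ?_
      simp
    have hm := monotoneOn_Icc_of_hasDerivAt
      (fun t ht => (hder t ht).continuousAt.continuousWithinAt)
      (fun t ht => hder t ⟨ht.1.le, ht.2.le⟩) (by
        intro t ht'
        have ht : t ∈ Icc c y := ⟨ht'.1.le, ht'.2.le⟩
        have hat := hpos t ht
        have hKt := hK t ht
        rw [Real.norm_eq_abs, abs_of_nonneg (by positivity)] at hKt
        have e1 : 2 * w t * (-((lam + α t) / h * b t)) +
            2 * (a t * b t) * ((lam - α t) / h * a t * w t) =
            (2 * w t * (a t * b t)) * ((lam - α t) / h * a t - (lam + α t) / h / a t) := by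
          field_simp
          ring
        have e2 : |2 * w t * (a t * b t)| ≤ w t ^ 2 + (a t * b t) ^ 2 := by
          rw [abs_le]
          constructor <;> nlinarith [sq_nonneg (w t + a t * b t), sq_nonneg (w t - a t * b t)]
        have e3 : |(lam - α t) / h * a t - (lam + α t) / h / a t| ≤ K := by
          refine (abs_sub _ _).trans ?_
          linarith
        have e4 := mul_le_mul e2 e3 (abs_nonneg _) (by positivity)
        rw [← abs_mul, ← e1] at e4
        have e5 := (abs_le.1 e4).1
        have e6 := Real.exp_pos (K * t)
        have : 0 ≤ ((2 * w t * (-((lam + α t) / h * b t)) +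
            2 * (a t * b t) * ((lam - α t) / h * a t * w t)) +
            (w t ^ 2 + (a t * b t) ^ 2) * K) * Real.exp (K * t) :=
          mul_nonneg (by linarith) e6.le
        linarith)
    have h1 := hm ⟨le_rfl, hc.2.le⟩ ⟨hc.2.le, le_rfl⟩ hc.2.le
    simp only [hE, hw, hb] at h1
    have h2 : (w c ^ 2 + (a c * b c) ^ 2) * Real.exp (K * c) ≤ 0 := by simpa using h1
    have h3 : w c ^ 2 + (a c * b c) ^ 2 ≤ 0 := nonpos_of_mul_nonpos_left h2 (Real.exp_pos _)
    have h4 : w c ^ 2 = 0 := le_antisymm (by nlinarith [sq_nonneg (a c * b c)]) (sq_nonneg _)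
    exact pow_eq_zero_iff (two_ne_zero) |>.1 h4
  have h1 : Tendsto w (𝓝[>] 0) (𝓝 (w 0)) := hS.continuous_w.continuousWithinAt
  have h2 : Tendsto w (𝓝[>] 0) (𝓝 0) := by
    refine tendsto_const_nhds.congr' ?_
    filter_upwards [Ioo_mem_nhdsGT hy] with t ht using (key t ht).symm
  have := tendsto_nhds_unique h1 h2
  rw [hS.w_zero] at this
  exact one_ne_zero this

/-- An interior zero of a nonnegative `w` is a local minimum, hence a common zero of `w` and `b`,
which is impossible. So `w` vanishes only at `Y`, which forces `b Y ≥ 0`. The sign of `z` then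
propagates from `0` where `α ≤ lam`, and backwards from `Y` where `α > lam`. -/
theorem z_nonneg_of_critical (hD : IsRadialData α a Y) (hS : IsRegularSolution α a h lam w b)
    (hh : 0 < h) (hlam : 0 < lam) (hw : ∀ y ∈ Icc 0 Y, 0 ≤ w y)
    (hzero : ∃ y ∈ Icc 0 Y, w y = 0) : ∀ y ∈ Icc 0 Y, 0 ≤ a y * b y := by
  have hα := hD.continuous_α
  obtain ⟨c, hc, hwc⟩ := hzero
  have hc0 : 0 < c := by
    rcases hc.1.eq_or_lt with h0 | h0
    · rw [← h0, hS.w_zero] at hwc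
      exact absurd hwc one_ne_zero
    · exact h0
  have hcoef : ∀ y ∈ Icc 0 Y, 0 < (lam + α y) / h := by
    intro y hy
    have h1 := hD.α_le hy
    have h2 := hD.α_pos
    exact div_pos (by linarith) hh
  have hcY : c = Y := by
    by_contra hne
    have hlt : c < Y := lt_of_le_of_ne hc.2 hne
    have hmin : IsLocalMin w c := by
      filter_upwards [Ioo_mem_nhds hc0 hlt] with t ht
      rw [hwc]
      exact hw t ⟨ht.1.le, ht.2.le⟩
    have h1 := hmin.hasDerivAt_eq_zero (hS.hasDerivAt_w hα hc0)
    have h2 : b c = 0 := by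
      rcases mul_eq_zero.1 (neg_eq_zero.1 h1) with h3 | h3
      · exact absurd h3 (hcoef c hc).ne'
      · exact h3
    exact hD.not_both_zero hS hc0 hwc h2
  subst hcY
  -- If `b` were negative at the end, `w` would increase strictly up to its zero there and be
  -- negative just before.
  have hbY : 0 ≤ b c := by
    by_contra! hneg
    have h1 : ∀ᶠ t in 𝓝 c, b t < 0 :=
      hS.continuous_b.continuousAt.eventually_lt continuousAt_const hneg
    obtain ⟨e, he, hsub⟩ := Metric.eventually_nhds_iff.1 h1
    set d := max (c / 2) (c - e / 2) with hd
    have hdc : d < c := max_lt (by linarith) (by linarith)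
    have hd0 : 0 < d := lt_of_lt_of_le (by linarith) (le_max_left _ _)
    have hde : c - e / 2 ≤ d := le_max_right _ _
    have hst : StrictMonoOn w (Icc d c) := by
      refine strictMonoOn_of_hasDerivWithinAt_pos (convex_Icc d c) hS.continuous_w.continuousOn
        (f' := fun t => -((lam + α t) / h * b t)) ?_ ?_
      · intro x hx
        rw [interior_Icc] at hx
        exact (hS.hasDerivAt_w hα (hd0.trans hx.1)).hasDerivWithinAt
      · intro x hx
        rw [interior_Icc] at hx
        have h2 := hcoef x ⟨(hd0.trans hx.1).le, hx.2.le⟩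
        have h3 : b x < 0 := by
          apply hsub
          rw [Real.dist_eq, abs_lt]
          constructor <;> linarith [hx.1, hx.2]
        have := mul_neg_of_pos_of_neg h2 h3
        linarith
    have h4 := hst ⟨le_rfl, hdc.le⟩ ⟨hdc.le, le_rfl⟩ hdc
    rw [hwc] at h4
    exact absurd (hw d ⟨hd0.le, hdc.le⟩) (not_le.2 h4)
  intro y hy
  rcases le_or_gt (α y) lam with hle | hlt
  · exact hD.z_nonneg_of_le hS hh hy hle fun t ht => hw t ⟨ht.1, ht.2.trans hy.2⟩
  · have hanti := antitoneOn_Icc_of_hasDerivAt (c := y) (d := c)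
      (hS.continuous_z hD.continuous_a).continuousOn
      (fun x hx => hS.hasDerivAt_z hα hD.continuous_a (hy.1.trans_lt hx.1)) (by
        intro x hx
        have h0 : 0 < x := hy.1.trans_lt hx.1
        have h1 := hw x ⟨h0.le, hx.2.le⟩
        have h2 := (hD.a_pos x h0).le
        have h3 : α y ≤ α x := hD.monotone_α hy ⟨h0.le, hx.2.le⟩ hx.1.le
        have h4 : (lam - α x) / h ≤ 0 := div_nonpos_of_nonpos_of_nonneg (by linarith) hh.le
        exact mul_nonpos_of_nonpos_of_nonneg (mul_nonpos_of_nonpos_of_nonneg h4 h2) h1)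
    have h1 := hanti ⟨le_rfl, hy.2⟩ ⟨hy.2, le_rfl⟩ hy.2
    exact (mul_nonneg (hD.a_pos c hc0).le hbY).trans h1

/-- The family of regular solutions, jointly continuous in the spectral parameter. -/
theorem exists_regularSolution (hD : IsRadialData α a Y) (h lam1 : ℝ) (h01 : α 0 ≤ lam1) :
    ∃ w b : ℝ × ℝ → ℝ, Continuous w ∧ ∀ lam ∈ Icc (α 0) lam1,
      IsRegularSolution α a h lam (fun y => w (lam, y)) (fun y => b (lam, y)) := by
  obtain ⟨C, hC⟩ := hD.bounded_α
  have hα := hD.continuous_α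
  -- Clamping the spectral parameter to `[α 0, lam1]` makes the coefficients bounded on the whole
  -- plane, as the fixed point requires, without changing them for admissible parameters.
  set cl : ℝ → ℝ := fun l => max (α 0) (min lam1 l) with hcl
  have hclc : Continuous cl := by fun_prop
  have hclb : ∀ l, |cl l| ≤ lam1 := by
    intro l
    have h0 := hD.α_pos
    rw [abs_of_nonneg (h0.le.trans (le_max_left _ _))]
    exact max_le h01 (min_le_left _ _)
  obtain ⟨w, b, hw, hb, h1, h2⟩ := exists_volterra_solution
    (p := fun x => (cl x.1 - α x.2) / h) (q := fun x => (cl x.1 + α x.2) / h)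
    (by fun_prop) (by fun_prop) (C := (lam1 + C) / |h|)
    (fun x => by
      rw [abs_div]
      gcongr
      exact (abs_sub _ _).trans (add_le_add (hclb _) (hC _)))
    (fun x => by
      rw [abs_div]
      gcongr
      exact (abs_add_le _ _).trans (add_le_add (hclb _) (hC _)))
    hD.continuous_a hD.monotone_a hD.a_pos
  refine ⟨w, b, hw, fun lam hlam => ?_⟩
  have e : cl lam = lam := by
    simp only [hcl, min_eq_right hlam.2, max_eq_right hlam.1]
  refine ⟨by fun_prop, by fun_prop, fun y hy => ?_, fun y hy => ?_⟩
  · have := h1 lam y hy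
    simpa only [e] using this
  · have := h2 lam y hy
    simpa only [e] using this

/-- For small `h` there is a spectral parameter in `[α 0, lam1]` whose regular solution is
nonnegative, together with its conjugate variable. -/
theorem exists_nonneg_solution (hD : IsRadialData α a Y) {lam1 : ℝ} (h01 : α 0 < lam1) :
    ∃ h₀ > 0, ∀ h, 0 < h → h < h₀ → ∃ lam ∈ Icc (α 0) lam1, ∃ w b : ℝ → ℝ,
      IsRegularSolution α a h lam w b ∧ (∀ y ∈ Icc 0 Y, 0 ≤ w y) ∧
      ∀ y ∈ Icc 0 Y, 0 ≤ a y * b y := by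
  have hα := hD.continuous_α
  have hY := hD.Y_pos
  have h0 := hD.α_pos
  obtain ⟨d, hd0, hdY, hdα⟩ : ∃ d, 0 < d ∧ d ≤ Y ∧ α d < lam1 := by
    have h1 : ∀ᶠ t in 𝓝[>] (0 : ℝ), α t < lam1 :=
      (hα.continuousAt.eventually_lt continuousAt_const h01).filter_mono nhdsWithin_le_nhds
    obtain ⟨d, h2, h3⟩ := (h1.and (Ioo_mem_nhdsGT hY)).exists
    exact ⟨d, h3.1, h3.2.le, h2⟩
  have hac := hD.a_pos (d / 2) (by linarith)
  have had := hD.a_pos d hd0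
  set k := min ((lam1 - α d) * a (d / 2)) (lam1 / a d) with hk
  have hkpos : 0 < k := by
    have : 0 < lam1 := by linarith
    have : 0 < lam1 - α d := by linarith
    exact lt_min (by positivity) (by positivity)
  refine ⟨k * (d - d / 2) / 2, ?_, fun h hh hlt => ?_⟩
  · have : 0 < d - d / 2 := by linarith
    positivity
  obtain ⟨w, b, hw, hfam⟩ := hD.exists_regularSolution h lam1 h01.le
  -- Compactness makes the set of parameters with a nonpositive value of `w` compact, so it has a
  -- smallest element.
  set bad : Set (ℝ × ℝ) := (Icc (α 0) lam1 ×ˢ Icc 0 Y) ∩ {x | w x ≤ 0} with hbad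
  have hcomp : IsCompact (Prod.fst '' bad) :=
    ((isCompact_Icc.prod isCompact_Icc).inter_right
      (isClosed_le hw continuous_const)).image continuous_fst
  have hne : (Prod.fst '' bad).Nonempty := by
    obtain ⟨y, hy, hwy⟩ := hD.exists_nonpos (hfam lam1 ⟨h01.le, le_rfl⟩) hh
      (c := d / 2) (d := d) (k := k) (by linarith) (by linarith) hdY hkpos
      (min_le_left _ _) (min_le_right _ _) hlt
    exact ⟨lam1, (lam1, y), ⟨⟨⟨h01.le, le_rfl⟩, hy⟩, hwy⟩, rfl⟩
  obtain ⟨lam, ⟨⟨l, y⟩, hmem, rfl⟩, hmin⟩ := hcomp.exists_isLeast hne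
  simp only at hmin
  have hl : l ∈ Icc (α 0) lam1 := hmem.1.1
  have hl0 : α 0 < l := by
    rcases hl.1.eq_or_lt with he | he
    · have h1 : 0 < w (l, y) := by
        have hS := hfam l hl
        rw [← he] at hS ⊢
        exact hD.w_pos_of_bottom hS hh hmem.1.2
      exact absurd hmem.2 (not_le.2 h1)
    · exact he
  have hwn : ∀ t ∈ Icc 0 Y, 0 ≤ w (l, t) := by
    intro t ht
    -- Below the smallest bad parameter `w` is positive; nonnegativity at that parameter follows by
    -- letting the parameter increase to it. This needs `α 0 < l`.
    have h1 : Tendsto (fun s => w (s, t)) (𝓝[<] l) (𝓝 (w (l, t))) := by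
      have : Continuous fun s => w (s, t) := by fun_prop
      exact this.continuousWithinAt
    refine ge_of_tendsto h1 ?_
    filter_upwards [Ioo_mem_nhdsLT hl0] with s hs
    by_contra! hneg
    exact absurd (hmin ⟨(s, t), ⟨⟨⟨hs.1.le, hs.2.le.trans hl.2⟩, ht⟩, hneg.le⟩, rfl⟩)
      (not_le.2 hs.2)
  refine ⟨l, hl, _, _, hfam l hl, hwn, ?_⟩
  exact hD.z_nonneg_of_critical (hfam l hl) hh (h0.trans hl0) hwn
    ⟨y, hmem.1.2, le_antisymm hmem.2 (hwn y hmem.1.2)⟩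

end IsRadialData

/-! ### Exponential decay across the barrier -/

namespace IsRadialData

variable {α a : ℝ → ℝ} {Y h lam : ℝ} {w b : ℝ → ℝ}

theorem continuous_density (hD : IsRadialData α a Y) (hS : IsRegularSolution α a h lam w b) :
    Continuous fun t => a t * (w t ^ 2 + b t ^ 2) := by
  have h1 := hD.continuous_a
  have h2 := hS.continuous_w
  have h3 := hS.continuous_b
  fun_prop

theorem density_nonneg (hD : IsRadialData α a Y) {t : ℝ} (ht : 0 < t) :
    0 ≤ a t * (w t ^ 2 + b t ^ 2) := by
  have := hD.a_pos t ht
  positivity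

/-- Exponential decay of the density across a barrier where `α ≥ lam + δ`. -/
theorem integral_density_le (hD : IsRadialData α a Y) (hS : IsRegularSolution α a h lam w b)
    (hh : 0 < h) (hlam : 0 < lam) (hw : ∀ y ∈ Icc 0 Y, 0 ≤ w y)
    (hz : ∀ y ∈ Icc 0 Y, 0 ≤ a y * b y)
    {y1 y2 y3 δ : ℝ} (h1 : 0 < y1) (h12 : y1 < y2) (h23 : y2 ≤ y3) (h3Y : y3 ≤ Y) (hδ : 0 < δ)
    (hbar : lam + δ ≤ α y1) :
    ∫ t in y3..Y, a t * (w t ^ 2 + b t ^ 2) ≤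
      h / (2 * δ * (y2 - y1)) * Real.exp (-(2 * δ * (y3 - y2)) / h) *
        ∫ t in y1..y2, a t * (w t ^ 2 + b t ^ 2) := by
  have hα := hD.continuous_α
  have ha := hD.continuous_a
  have hQc := hD.continuous_density hS
  set Q : ℝ → ℝ := fun t => a t * (w t ^ 2 + b t ^ 2) with hQ
  -- `P` plays the role of a flux: its derivative is `-((α - lam) a w² + (lam + α) a b²) / h`, so in
  -- the barrier it controls the density.
  set P : ℝ → ℝ := fun t => w t * (a t * b t) with hP
  set P' : ℝ → ℝ := fun t =>
    -((lam + α t) / h * b t) * (a t * b t) + w t * ((lam - α t) / h * a t * w t) with hP'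
  have hPc : Continuous P := hS.continuous_w.mul (hS.continuous_z ha)
  have hPd : ∀ t, 0 < t → HasDerivAt P (P' t) t := fun t ht =>
    (hS.hasDerivAt_w hα ht).mul (hS.hasDerivAt_z hα ha ht)
  have hbound : ∀ t ∈ Icc y1 Y, P' t ≤ -(δ / h * Q t) := by
    intro t ht
    have h0 := h1.trans_le ht.1
    have hat := (hD.a_pos t h0).le
    have e1 : α y1 ≤ α t := hD.monotone_α ⟨h1.le, ht.1.trans ht.2⟩ ⟨h0.le, ht.2⟩ ht.1
    have e2 : 0 ≤ (α t - lam - δ) / h := div_nonneg (by linarith) hh.le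
    have e3 : 0 ≤ (lam + α t - δ) / h := div_nonneg (by linarith) hh.le
    have e4 : -(δ / h * Q t) - P' t =
        (α t - lam - δ) / h * (a t * w t ^ 2) + (lam + α t - δ) / h * (a t * b t ^ 2) := by
      simp only [hQ, hP']
      ring
    have : 0 ≤ -(δ / h * Q t) - P' t := by rw [e4]; positivity
    linarith
  have hPQ : ∀ t, 0 < t → 2 * P t ≤ Q t := by
    intro t ht
    have hat := (hD.a_pos t ht).le
    have : Q t - 2 * P t = a t * (w t - b t) ^ 2 := by simp only [hQ, hP]; ring
    have : 0 ≤ Q t - 2 * P t := by rw [this]; positivity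
    linarith
  have hQn : ∀ t, 0 < t → 0 ≤ Q t := fun t ht => hD.density_nonneg ht
  have hP0 : ∀ t ∈ Icc 0 Y, 0 ≤ P t := fun t ht => mul_nonneg (hw t ht) (hz t ht)
  have hδh : 0 < δ / h := div_pos hδ hh
  -- Integration of `P' ≤ -(δ / h) Q` up to `Y`; the boundary term is dropped because `P Y ≥ 0`.
  have s1 : δ / h * ∫ t in y3..Y, Q t ≤ P y3 := by
    have hd : ∀ t, 0 < t → HasDerivAt (fun t => P t + δ / h * ∫ s in y3..t, Q s)
        (P' t + δ / h * Q t) t := fun t ht =>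
      (hPd t ht).add ((hQc.integral_hasStrictDerivAt y3 t).hasDerivAt.const_mul _)
    have hm := antitoneOn_Icc_of_hasDerivAt (c := y3) (d := Y)
      (fun t ht => (hd t (by linarith [ht.1])).continuousAt.continuousWithinAt)
      (fun t ht => hd t (by linarith [ht.1])) (by
        intro t ht
        have := hbound t ⟨by linarith [ht.1], ht.2.le⟩
        linarith)
    have e := hm ⟨le_rfl, h3Y⟩ ⟨h3Y, le_rfl⟩ h3Y
    simp only [intervalIntegral.integral_same, mul_zero, add_zero] at e
    have := hP0 Y ⟨hD.Y_pos.le, le_rfl⟩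
    linarith
  -- Since `2 P ≤ Q`, the same inequality reads `P' ≤ -(2 δ / h) P`, which is the source of the
  -- exponential.
  have s2 : P y3 ≤ Real.exp (-(2 * δ * (y3 - y2)) / h) * P y2 := by
    have hd : ∀ t, 0 < t → HasDerivAt (fun t => P t * Real.exp (2 * δ / h * t))
        (P' t * Real.exp (2 * δ / h * t) + P t * (Real.exp (2 * δ / h * t) * (2 * δ / h * 1))) t :=
      fun t ht => (hPd t ht).mul ((hasDerivAt_id t).const_mul (2 * δ / h)).exp
    have hm := antitoneOn_Icc_of_hasDerivAt (c := y2) (d := y3)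
      (fun t ht => (hd t (by linarith [ht.1])).continuousAt.continuousWithinAt)
      (fun t ht => hd t (by linarith [ht.1])) (by
        intro t ht
        have h0 : 0 < t := by linarith [ht.1]
        have e1 := hbound t ⟨by linarith [ht.1], by linarith [ht.2]⟩
        have e2 := mul_le_mul_of_nonneg_left (hPQ t h0) hδh.le
        have e3 : P' t + P t * (2 * δ / h) ≤ 0 := by
          have : P t * (2 * δ / h) = δ / h * (2 * P t) := by ring
          linarith
        have := mul_nonpos_of_nonpos_of_nonneg e3 (Real.exp_pos (2 * δ / h * t)).le
        linarith)
    have e := hm ⟨le_rfl, h23⟩ ⟨h23, le_rfl⟩ h23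
    simp only at e
    have e4 : Real.exp (-(2 * δ * (y3 - y2)) / h) =
        Real.exp (2 * δ / h * y2) / Real.exp (2 * δ / h * y3) := by
      rw [← Real.exp_sub]; congr 1; ring
    rw [e4, div_mul_eq_mul_div, le_div_iff₀ (Real.exp_pos _)]
    linarith
  -- `P` is nonincreasing in the barrier, so its value at `y2` is below its mean over `[y1, y2]`;
  -- this returns from a pointwise value to the density.
  have s3 : (y2 - y1) * P y2 ≤ 1 / 2 * ∫ t in y1..y2, Q t := by
    have hm := antitoneOn_Icc_of_hasDerivAt (c := y1) (d := y2) hPc.continuousOn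
      (fun t ht => hPd t (h1.trans ht.1)) (by
        intro t ht
        have h0 : 0 < t := by linarith [ht.1]
        have e1 := hbound t ⟨ht.1.le, by linarith [ht.2]⟩
        have e2 := mul_nonneg hδh.le (hQn t h0)
        linarith)
    have e1 : ∫ _ in y1..y2, P y2 ≤ ∫ t in y1..y2, 1 / 2 * Q t := by
      refine intervalIntegral.integral_mono_on h12.le (by simp)
        ((hQc.const_mul _ : Continuous fun t => 1 / 2 * Q t).intervalIntegrable _ _) ?_
      intro t ht
      have := hm ht ⟨h12.le, le_rfl⟩ ht.2
      have := hPQ t (h1.trans_le ht.1)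
      linarith
    rwa [intervalIntegral.integral_const, intervalIntegral.integral_const_mul, smul_eq_mul] at e1
  have hy : 0 < y2 - y1 := by linarith
  set e := Real.exp (-(2 * δ * (y3 - y2)) / h) with he
  have hepos : 0 < e := Real.exp_pos _
  have s4 : P y2 ≤ (1 / 2 * ∫ t in y1..y2, Q t) / (y2 - y1) := by
    rw [le_div_iff₀ hy]; linarith
  have s5 : δ / h * ∫ t in y3..Y, Q t ≤ e * ((1 / 2 * ∫ t in y1..y2, Q t) / (y2 - y1)) :=
    s1.trans (s2.trans (mul_le_mul_of_nonneg_left s4 hepos.le))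
  have s6 : (∫ t in y3..Y, Q t) = h / δ * (δ / h * ∫ t in y3..Y, Q t) := by
    field_simp
  rw [s6]
  refine (mul_le_mul_of_nonneg_left s5 (by positivity)).trans (le_of_eq ?_)
  field_simp

/-- Solutions concentrated in the well, with an exponentially small part near the end `Y`. -/
theorem exists_concentrated (hD : IsRadialData α a Y) {lam1 : ℝ} (h01 : α 0 < lam1)
    (h1Y : lam1 < α Y) :
    ∃ y3 ∈ Ioo 0 Y, ∃ C > 0, ∃ d > 0, ∃ h₀ > 0, ∀ h, 0 < h → h < h₀ →
      ∃ lam ∈ Icc (α 0) lam1, ∃ w b : ℝ → ℝ, IsRegularSolution α a h lam w b ∧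
        0 < ∫ t in (0 : ℝ)..y3, a t * (w t ^ 2 + b t ^ 2) ∧
        ∫ t in y3..Y, a t * (w t ^ 2 + b t ^ 2) ≤
          C * Real.exp (-d / h) * ∫ t in (0 : ℝ)..y3, a t * (w t ^ 2 + b t ^ 2) := by
  have hα := hD.continuous_α
  have hY := hD.Y_pos
  have h0 := hD.α_pos
  -- The strict inequality `lam1 < α Y` leaves room for a barrier starting before `Y`, with a gap
  -- `δ` independent of `h`.
  obtain ⟨y1, hy10, hy1Y, hy1⟩ : ∃ d, 0 < d ∧ d < Y ∧ lam1 < α d := by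
    have h1 : ∀ᶠ t in 𝓝[<] Y, lam1 < α t :=
      (continuousAt_const.eventually_lt hα.continuousAt h1Y).filter_mono nhdsWithin_le_nhds
    obtain ⟨d, h2, h3⟩ := (h1.and (Ioo_mem_nhdsLT hY)).exists
    exact ⟨d, h3.1, h3.2, h2⟩
  obtain ⟨h₀, hh₀, hsol⟩ := hD.exists_nonneg_solution h01
  obtain ⟨y2, h12, h2Y⟩ := exists_between hy1Y
  obtain ⟨y3, h23, h3Y⟩ := exists_between h2Y
  set δ := α y1 - lam1 with hδ
  have hδ0 : 0 < δ := by linarith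
  have h12' : 0 < y2 - y1 := by linarith
  have h23' : 0 < y3 - y2 := by linarith
  refine ⟨y3, ⟨by linarith, h3Y⟩, 1 / (2 * δ * (y2 - y1)), by positivity, 2 * δ * (y3 - y2),
    by positivity, min h₀ 1, lt_min hh₀ one_pos, fun h hh hlt => ?_⟩
  obtain ⟨lam, hlam, w, b, hS, hw, hz⟩ := hsol h hh (hlt.trans_le (min_le_left _ _))
  have hlt1 : h < 1 := hlt.trans_le (min_le_right _ _)
  have hQc := hD.continuous_density hS
  have hy3 : 0 < y3 := by linarith
  refine ⟨lam, hlam, w, b, hS, ?_, ?_⟩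
  · have hw1 : ∀ᶠ t in 𝓝[>] (0 : ℝ), 0 < w t := by
      have : (0 : ℝ) < w 0 := by rw [hS.w_zero]; exact one_pos
      exact (continuousAt_const.eventually_lt hS.continuous_w.continuousAt this).filter_mono
        nhdsWithin_le_nhds
    obtain ⟨c, hc, hc3⟩ := (hw1.and (Ioo_mem_nhdsGT hy3)).exists
    refine intervalIntegral.integral_pos hy3 hQc.continuousOn
      (fun t ht => hD.density_nonneg ht.1) ⟨c, ⟨hc3.1.le, hc3.2.le⟩, ?_⟩
    have := hD.a_pos c hc3.1
    positivity
  · refine (hD.integral_density_le hS hh (h0.trans_le hlam.1) hw hz hy10 h12 h23.le h3Y.le hδ0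
      (by linarith [hlam.2])).trans ?_
    have e1 : ∫ t in y1..y2, a t * (w t ^ 2 + b t ^ 2) ≤
        ∫ t in (0 : ℝ)..y3, a t * (w t ^ 2 + b t ^ 2) := by
      refine intervalIntegral.integral_mono_interval hy10.le h12.le h23.le ?_
        (hQc.intervalIntegrable _ _)
      rw [Filter.EventuallyLE, ae_restrict_iff' measurableSet_Ioc]
      exact Eventually.of_forall fun t ht => hD.density_nonneg ht.1
    have e2 : 0 ≤ ∫ t in y1..y2, a t * (w t ^ 2 + b t ^ 2) :=
      intervalIntegral.integral_nonneg h12.le fun t ht =>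
        hD.density_nonneg (hy10.trans_le ht.1)
    gcongr

end IsRadialData

/-! ### The metric function and the tortoise coordinate -/

section Geometry

variable {M l : ℝ}

theorem horizon_pos (hM : 0 < M) (hl : 0 < l) : 0 < horizon M l := by
  have h1 : M * l ^ 2 ≤ Real.sqrt (M ^ 2 * l ^ 4 + l ^ 6 / 27) := by
    apply Real.le_sqrt_of_sq_le
    have : 0 ≤ l ^ 6 / 27 := by positivity
    nlinarith
  have h2 : 0 < M * l ^ 2 := by positivity
  have h3 := Real.rpow_lt_rpow (z := 1 / 3)
    (x := Real.sqrt (M ^ 2 * l ^ 4 + l ^ 6 / 27) - M * l ^ 2)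
    (y := Real.sqrt (M ^ 2 * l ^ 4 + l ^ 6 / 27) + M * l ^ 2) (by linarith) (by linarith)
    (by norm_num)
  exact sub_pos.2 h3

theorem F_eq (hM : 0 < M) (hl : 0 < l) {r : ℝ} (hr : 0 < r) :
    F M l r = (r - horizon M l) *
      (1 + (r ^ 2 + r * horizon M l + horizon M l ^ 2) / l ^ 2) / r := by
  have h := horizon_cubic M l hM
  generalize horizon M l = q at h
  have hM2 : 2 * M = (q ^ 3 + l ^ 2 * q) / l ^ 2 := by
    rw [eq_div_iff (by positivity)]; linarith
  rw [F, hM2]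
  field_simp
  ring

/-- In the factorization through the horizon, only the term in `r ^ 2` is kept. It gives positivity
outside the horizon and the quadratic growth that makes `1 / F` integrable at infinity. -/
theorem F_lower (hM : 0 < M) (hl : 0 < l) {r : ℝ} (hr : horizon M l ≤ r) :
    (r - horizon M l) * r / l ^ 2 ≤ F M l r := by
  have h0 := horizon_pos hM hl
  have hr0 : 0 < r := h0.trans_le hr
  rw [F_eq hM hl hr0]
  have h1 : (r - horizon M l) * r / l ^ 2 = (r - horizon M l) * (r ^ 2 / l ^ 2) / r := by
    field_simp
  rw [h1]
  have h2 : 0 ≤ r - horizon M l := by linarith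
  have h3 : r ^ 2 / l ^ 2 ≤ 1 + (r ^ 2 + r * horizon M l + horizon M l ^ 2) / l ^ 2 := by
    have : r ^ 2 / l ^ 2 ≤ (r ^ 2 + r * horizon M l + horizon M l ^ 2) / l ^ 2 := by
      gcongr
      have := mul_pos hr0 h0
      nlinarith [sq_nonneg (horizon M l)]
    linarith
  gcongr

theorem F_pos (hM : 0 < M) (hl : 0 < l) {r : ℝ} (hr : horizon M l < r) : 0 < F M l r := by
  refine lt_of_lt_of_le ?_ (F_lower hM hl hr.le)
  have h0 := horizon_pos hM hl
  have h1 : 0 < r - horizon M l := by linarith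
  have h2 : 0 < r := by linarith
  positivity

theorem F_horizon (hM : 0 < M) (hl : 0 < l) : F M l (horizon M l) = 0 := by
  rw [F_eq hM hl (horizon_pos hM hl)]; simp

theorem hasDerivAt_F {r : ℝ} (hr : r ≠ 0) :
    HasDerivAt (F M l) (2 * M / r ^ 2 + 2 * r / l ^ 2) r := by
  have h1 := ((hasDerivAt_inv hr).const_mul (2 * M)).const_sub 1
  have h2 := ((hasDerivAt_id r).fun_pow 2).div_const (l ^ 2)
  have h3 := h1.add h2
  refine (h3.congr_of_eventuallyEq ?_).congr_deriv ?_
  · exact Eventually.of_forall fun x => by simp [F, div_eq_mul_inv]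
  · simp
    field_simp

theorem continuousOn_F : ContinuousOn (F M l) (Ioi 0) := fun _ hr =>
  (hasDerivAt_F (ne_of_gt hr)).continuousAt.continuousWithinAt

/-- At the horizon `F` vanishes while `F'` is positive, so the expression is negative there. -/
theorem horizon_lt_of_nonneg (hM : 0 < M) (hl : 0 < l) {rp : ℝ}
    (hrp : ∀ r : ℝ, rp ≤ r → 0 ≤ F M l r / (4 * l ^ 2) - (deriv (F M l) r) ^ 2 / 16) :
    horizon M l < rp := by
  by_contra! hle
  have h := hrp _ hle
  have h0 := horizon_pos hM hl
  rw [F_horizon hM hl, (hasDerivAt_F h0.ne').deriv] at h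
  have : 0 < (2 * M / horizon M l ^ 2 + 2 * horizon M l / l ^ 2) ^ 2 / 16 := by positivity
  simp only [zero_div] at h
  linarith

/-- The terms of order zero in `1 / r` cancel, and the expression is `(r - 4 M) / (4 l² r) - M² / (4
r⁴)`. This is how the hypothesis on `r₊` enters the monotonicity of the potential. -/
theorem four_mul_le_of_nonneg (hM : 0 < M) (hl : 0 < l) {r : ℝ} (hr : 0 < r)
    (h : 0 ≤ F M l r / (4 * l ^ 2) - (deriv (F M l) r) ^ 2 / 16) : 4 * M ≤ r := by
  rw [(hasDerivAt_F hr.ne').deriv, F] at h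
  have h1 : (1 - 2 * M / r + r ^ 2 / l ^ 2) / (4 * l ^ 2) -
      (2 * M / r ^ 2 + 2 * r / l ^ 2) ^ 2 / 16 =
      (r - 4 * M) / (4 * l ^ 2 * r) - M ^ 2 / (4 * r ^ 4) := by
    field_simp
    ring
  rw [h1] at h
  have h2 : 0 ≤ M ^ 2 / (4 * r ^ 4) := by positivity
  have h3 : 0 ≤ (r - 4 * M) / (4 * l ^ 2 * r) := by linarith
  have h4 : 0 < 4 * l ^ 2 * r := by positivity
  by_contra! h5
  have := div_neg_of_neg_of_pos (show r - 4 * M < 0 by linarith) h4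
  linarith

theorem continuousOn_inv_F (hM : 0 < M) (hl : 0 < l) :
    ContinuousOn (fun r => (F M l r)⁻¹) (Ioi (horizon M l)) :=
  (continuousOn_F.mono fun _ hr => (horizon_pos hM hl).trans hr).inv₀
    fun _ hr => (F_pos hM hl hr).ne'

theorem integrableOn_inv_F (hM : 0 < M) (hl : 0 < l) {r : ℝ} (hr : horizon M l < r) :
    IntegrableOn (fun r => (F M l r)⁻¹) (Ioi r) := by
  have h0 := horizon_pos hM hl
  have hr0 : 0 < r := h0.trans hr
  have hc : 0 < 1 - horizon M l / r := by
    rw [sub_pos, div_lt_one hr0]; exact hr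
  have hg : IntegrableOn (fun t : ℝ => l ^ 2 / (1 - horizon M l / r) * t ^ (-2 : ℝ)) (Ioi r) :=
    (integrableOn_Ioi_rpow_of_lt (by norm_num) hr0).const_mul _
  refine Integrable.mono' hg ?_ ?_
  · exact ((continuousOn_inv_F hM hl).mono fun t ht => hr.trans ht).aestronglyMeasurable
      measurableSet_Ioi
  · rw [ae_restrict_iff' measurableSet_Ioi]
    refine Eventually.of_forall fun t ht => ?_
    have ht' : r < t := ht
    have ht0 : 0 < t := hr0.trans ht'
    have hF := F_pos hM hl (hr.trans ht')
    rw [Real.norm_eq_abs, abs_of_pos (inv_pos.2 hF), Real.rpow_neg ht0.le]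
    have h1 : (1 - horizon M l / r) * t ^ 2 / l ^ 2 ≤ F M l t := by
      refine le_trans ?_ (F_lower hM hl (hr.trans ht').le)
      have h2 : horizon M l ≤ horizon M l / r * t := by
        rw [div_mul_eq_mul_div, le_div_iff₀ hr0]
        exact mul_le_mul_of_nonneg_left ht'.le h0.le
      have h3 : (1 - horizon M l / r) * t ≤ t - horizon M l := by linarith
      have h4 := mul_le_mul_of_nonneg_right h3 ht0.le
      rw [mul_assoc, ← sq] at h4
      exact div_le_div_of_nonneg_right h4 (by positivity)
    calc (F M l t)⁻¹ ≤ ((1 - horizon M l / r) * t ^ 2 / l ^ 2)⁻¹ := by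
          apply inv_anti₀ (by positivity) h1
      _ = _ := by
          norm_num
          field_simp

theorem tortoise_eq_add (hM : 0 < M) (hl : 0 < l) {r₁ r₂ : ℝ} (h₁ : horizon M l < r₁)
    (h₂ : horizon M l < r₂) :
    tortoise M l r₂ = tortoise M l r₁ + ∫ r in r₁..r₂, (F M l r)⁻¹ := by
  have := intervalIntegral.integral_interval_add_Ioi (integrableOn_inv_F hM hl h₁)
    (integrableOn_inv_F hM hl h₂)
  simp only [tortoise]
  linarith

theorem strictMonoOn_tortoise (hM : 0 < M) (hl : 0 < l) :
    StrictMonoOn (tortoise M l) (Ioi (horizon M l)) := by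
  intro r₁ h₁ r₂ h₂ h12
  rw [tortoise_eq_add hM hl h₁ h₂]
  have : 0 < ∫ r in r₁..r₂, (F M l r)⁻¹ := by
    refine intervalIntegral.integral_pos h12
      ((continuousOn_inv_F hM hl).mono fun t ht => lt_of_lt_of_le h₁ ht.1) ?_ ?_
    · exact fun t ht => (inv_pos.2 (F_pos hM hl (lt_trans h₁ ht.1))).le
    · exact ⟨r₁, ⟨le_rfl, h12.le⟩, inv_pos.2 (F_pos hM hl h₁)⟩
  linarith

theorem tortoise_neg (hM : 0 < M) (hl : 0 < l) {r : ℝ} (hr : horizon M l < r) :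
    tortoise M l r < 0 := by
  have hr1 : horizon M l < r + 1 := by linarith
  have h1 := strictMonoOn_tortoise hM hl hr hr1 (by linarith)
  have h2 : tortoise M l (r + 1) ≤ 0 := by
    rw [tortoise, neg_nonpos]
    exact setIntegral_nonneg measurableSet_Ioi fun t ht =>
      (inv_pos.2 (F_pos hM hl (lt_trans hr1 ht))).le
  linarith

theorem tendsto_tortoise (hM : 0 < M) (hl : 0 < l) :
    Tendsto (tortoise M l) atTop (𝓝 0) := by
  have hr : horizon M l < horizon M l + 1 := by linarith
  have h1 := (intervalIntegral_tendsto_integral_Ioi _ (integrableOn_inv_F hM hl hr)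
    tendsto_id).const_add (tortoise M l (horizon M l + 1))
  have h2 : tortoise M l (horizon M l + 1) +
      ∫ r in Ioi (horizon M l + 1), (F M l r)⁻¹ = 0 := by simp [tortoise]
  rw [h2] at h1
  refine h1.congr' ?_
  filter_upwards [eventually_gt_atTop (horizon M l)] with r hr'
  exact (tortoise_eq_add hM hl hr hr').symm

theorem exists_tortoise_eq (hM : 0 < M) (hl : 0 < l) {r₁ x : ℝ} (h₁ : horizon M l < r₁)
    (hx : tortoise M l r₁ ≤ x) (hx0 : x < 0) : ∃ r, r₁ ≤ r ∧ tortoise M l r = x := by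
  obtain ⟨r₂, hr₂, hlt⟩ := (((tendsto_tortoise hM hl).eventually (lt_mem_nhds hx0)).and
    (eventually_ge_atTop r₁)).exists
  have hc : ContinuousOn (tortoise M l) (Icc r₁ r₂) := by
    have h1 : ContinuousOn (fun r => tortoise M l r₁ + ∫ t in r₁..r, (F M l t)⁻¹)
        (uIcc r₁ r₂) := by
      refine continuousOn_const.add
        (intervalIntegral.continuousOn_primitive_interval ?_)
      rw [uIcc_of_le hlt]
      exact ((continuousOn_inv_F hM hl).mono fun t ht =>
        lt_of_lt_of_le h₁ ht.1).integrableOn_Icc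
    rw [uIcc_of_le hlt] at h1
    exact h1.congr fun r hr => tortoise_eq_add hM hl h₁ (lt_of_lt_of_le h₁ hr.1)
  obtain ⟨r, hr, he⟩ := intermediate_value_Icc hlt hc ⟨hx, hr₂.le⟩
  exact ⟨r, hr.1, he⟩

theorem radius_tortoise (hM : 0 < M) (hl : 0 < l) {r : ℝ} (hr : horizon M l < r) :
    radius M l (tortoise M l r) = r :=
  (strictMonoOn_tortoise hM hl).injOn.leftInvOn_invFunOn hr

theorem strictMonoOn_radius (hM : 0 < M) (hl : 0 < l) {r₁ : ℝ} (h₁ : horizon M l < r₁) :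
    StrictMonoOn (radius M l) (Ico (tortoise M l r₁) 0) := by
  intro x hx y hy hxy
  obtain ⟨r, hr, rfl⟩ := exists_tortoise_eq hM hl h₁ hx.1 hx.2
  obtain ⟨s, hs, rfl⟩ := exists_tortoise_eq hM hl h₁ hy.1 hy.2
  have hr' := h₁.trans_le hr
  have hs' := h₁.trans_le hs
  rw [radius_tortoise hM hl hr', radius_tortoise hM hl hs']
  exact ((strictMonoOn_tortoise hM hl).lt_iff_lt hr' hs').1 hxy

theorem continuousAt_radius (hM : 0 < M) (hl : 0 < l) {r₁ x : ℝ} (h₁ : horizon M l < r₁)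
    (hx : x ∈ Ioo (tortoise M l r₁) 0) : ContinuousAt (radius M l) x := by
  refine ((strictMonoOn_radius hM hl h₁).mono Ioo_subset_Ico_self).continuousAt_of_image_mem_nhds
    (Ioo_mem_nhds hx.1 hx.2) ?_
  obtain ⟨r, hr, rfl⟩ := exists_tortoise_eq hM hl h₁ hx.1.le hx.2
  have hr' := h₁.trans_le hr
  rw [radius_tortoise hM hl hr']
  have hlt : r₁ < r := ((strictMonoOn_tortoise hM hl).lt_iff_lt h₁ hr').1 hx.1
  refine mem_of_superset (Ioi_mem_nhds hlt) fun s hs => ?_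
  have hs' : horizon M l < s := h₁.trans hs
  exact ⟨tortoise M l s, ⟨strictMonoOn_tortoise hM hl h₁ hs' hs, tortoise_neg hM hl hs'⟩,
    radius_tortoise hM hl hs'⟩

theorem le_radius (hM : 0 < M) (hl : 0 < l) {r₁ x : ℝ} (h₁ : horizon M l < r₁)
    (hx : x ∈ Ico (tortoise M l r₁) 0) : r₁ ≤ radius M l x := by
  obtain ⟨r, hr, rfl⟩ := exists_tortoise_eq hM hl h₁ hx.1 hx.2
  rwa [radius_tortoise hM hl (h₁.trans_le hr)]

end Geometry

/-! ### The weight and the potentials in the variable `y = -x` -/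

/-- A positive increasing solution of `s' = β s` on `]0, ∞[`, extended continuously to `ℝ`. -/
theorem exists_monotone_weight {β : ℝ → ℝ} (hβ : ContinuousOn β (Ioi 0))
    (hβ0 : ∀ y, 0 < y → 0 ≤ β y) {Y : ℝ} (hY : 0 < Y) :
    ∃ s : ℝ → ℝ, Continuous s ∧ Monotone s ∧ (∀ y, 0 ≤ s y) ∧ (∀ y, 0 < y → 0 < s y) ∧
      ∀ y, 0 < y → HasDerivAt s (β y * s y) y := by
  set s₁ : ℝ → ℝ := fun y => Real.exp (∫ t in Y..y, β t) with hs₁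
  have hpos : ∀ y, 0 < s₁ y := fun y => Real.exp_pos _
  have hder : ∀ y, 0 < y → HasDerivAt s₁ (β y * s₁ y) y := by
    intro y hy
    have h1 : HasDerivAt (fun y => ∫ t in Y..y, β t) (β y) y := by
      refine intervalIntegral.integral_hasDerivAt_right ?_ ?_ ?_
      · refine ContinuousOn.intervalIntegrable (hβ.mono fun t ht => ?_)
        exact lt_of_lt_of_le (lt_min hY hy) ht.1
      · exact hβ.stronglyMeasurableAtFilter isOpen_Ioi y hy
      · exact hβ.continuousAt (Ioi_mem_nhds hy)
    exact h1.exp.congr_deriv (mul_comm _ _)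
  have hmono : MonotoneOn s₁ (Ioi 0) := by
    refine monotoneOn_of_hasDerivWithinAt_nonneg (f' := fun y => β y * s₁ y) (convex_Ioi 0)
      (fun y hy => (hder y hy).continuousAt.continuousWithinAt) ?_ ?_
    · intro x hx
      rw [interior_Ioi] at hx
      exact (hder x hx).hasDerivWithinAt
    · intro x hx
      rw [interior_Ioi] at hx
      exact mul_nonneg (hβ0 x hx) (hpos x).le
  have hbdd : BddBelow (s₁ '' Ioi 0) := ⟨0, by rintro _ ⟨y, _, rfl⟩; exact (hpos y).le⟩
  -- The limit at `0` exists by monotonicity. It may be zero or positive; the regular solution is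
  -- constructed in either case.
  have hlim := hmono.tendsto_nhdsGT hbdd
  set L := sInf (s₁ '' Ioi 0) with hL
  have hL0 : 0 ≤ L := Real.sInf_nonneg (by rintro _ ⟨y, _, rfl⟩; exact (hpos y).le)
  have hLle : ∀ y, 0 < y → L ≤ s₁ y := fun y hy => csInf_le hbdd ⟨y, hy, rfl⟩
  set s : ℝ → ℝ := fun y => if y ≤ 0 then L else s₁ y with hs
  have hs0 : ∀ y, y ≤ 0 → s y = L := fun y hy => if_pos hy
  have hs1 : ∀ y, 0 < y → s y = s₁ y := fun y hy => if_neg (not_le.2 hy)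
  have hderS : ∀ y, 0 < y → HasDerivAt s (β y * s y) y := by
    intro y hy
    rw [hs1 y hy]
    refine (hder y hy).congr_of_eventuallyEq ?_
    filter_upwards [lt_mem_nhds hy] with t ht using hs1 t ht
  refine ⟨s, ?_, ?_, ?_, ?_, hderS⟩
  · rw [continuous_iff_continuousAt]
    intro y
    rcases lt_trichotomy y 0 with hy | rfl | hy
    · have : s =ᶠ[𝓝 y] fun _ => L := by
        filter_upwards [gt_mem_nhds hy] with t ht using hs0 t (le_of_lt ht)
      exact continuousAt_const.congr this.symm
    · rw [continuousAt_iff_continuous_left'_right']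
      constructor
      · rw [ContinuousWithinAt, hs0 0 le_rfl]
        refine tendsto_const_nhds.congr' ?_
        filter_upwards [self_mem_nhdsWithin] with t ht using (hs0 t (le_of_lt ht)).symm
      · rw [ContinuousWithinAt, hs0 0 le_rfl]
        refine hlim.congr' ?_
        filter_upwards [self_mem_nhdsWithin] with t ht using (hs1 t ht).symm
    · exact (hderS y hy).continuousAt
  · intro x y hxy
    rcases le_or_gt y 0 with hy | hy
    · rw [hs0 y hy, hs0 x (hxy.trans hy)]
    · rcases le_or_gt x 0 with hx | hx
      · rw [hs0 x hx, hs1 y hy]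
        exact hLle y hy
      · rw [hs1 x hx, hs1 y hy]
        exact hmono hx hy hxy
  · intro y
    rcases le_or_gt y 0 with hy | hy
    · rw [hs0 y hy]; exact hL0
    · rw [hs1 y hy]; exact (hpos y).le
  · intro y hy
    rw [hs1 y hy]
    exact hpos y

section Profile

variable {M l : ℝ}

/-- The potentials in the variable `y = -x ∈ ]0, Y]`, where `Y = -x(r₁)` with `r₁ ≥ 4 M`. -/
theorem exists_radialData (hM : 0 < M) (hl : 0 < l) {m : ℝ} (hm : 0 < m) {r₁ : ℝ}
    (h₁ : horizon M l < r₁) (h4 : 4 * M ≤ r₁) :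
    ∃ α β s : ℝ → ℝ, IsRadialData α (fun y => s y ^ 2) (-tortoise M l r₁) ∧ α 0 = 1 / l ∧
      (∀ y ∈ Ioc 0 (-tortoise M l r₁), α y = A M l (-y)) ∧
      (∀ y ∈ Ioc 0 (-tortoise M l r₁), β y = B M l (-y)) ∧ ContinuousOn β (Ioi 0) ∧
      Continuous s ∧ (∀ y, 0 < y → 0 < s y) ∧
      ∀ y, 0 < y → HasDerivAt s (m * β y * s y) y := by
  have hY : 0 < -tortoise M l r₁ := by linarith [tortoise_neg hM hl h₁]
  set Y := -tortoise M l r₁ with hYdef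
  have hr₁ : 0 < r₁ := (horizon_pos hM hl).trans h₁
  -- A radius slightly closer to the horizon makes `tortoise M l r₁` an interior point, so that
  -- continuity of the inverse holds there too.
  obtain ⟨r₀, hr₀, hr₀₁⟩ := exists_between h₁
  have hxr : tortoise M l r₀ < tortoise M l r₁ := strictMonoOn_tortoise hM hl hr₀ h₁ hr₀₁
  -- The radius is frozen beyond `Y`, so that the coefficients are defined and continuous on all of
  -- `]0, ∞[`.
  set R : ℝ → ℝ := fun y => radius M l (-min y Y) with hR
  have hmem : ∀ y, 0 < y → -min y Y ∈ Ico (tortoise M l r₁) 0 := by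
    intro y hy
    have h1 : 0 < min y Y := lt_min hy hY
    have h2 : min y Y ≤ Y := min_le_right _ _
    exact ⟨by linarith, by linarith⟩
  have hRle : ∀ y, 0 < y → r₁ ≤ R y := fun y hy => le_radius hM hl h₁ (hmem y hy)
  have hRc : ContinuousOn R (Ioi 0) := by
    intro y hy
    have h1 := hmem y hy
    have h2 : ContinuousAt (radius M l) (-min y Y) :=
      continuousAt_radius hM hl hr₀ ⟨hxr.trans_le h1.1, h1.2⟩
    have h3 : ContinuousAt (fun y : ℝ => -min y Y) y := by fun_prop
    exact (ContinuousAt.comp (f := fun y : ℝ => -min y Y) h2 h3).continuousWithinAt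
  have hRanti : ∀ y z, 0 < y → y ≤ z → R z ≤ R y := fun y z hy hyz =>
    (strictMonoOn_radius hM hl h₁).monotoneOn (hmem z (hy.trans_le hyz)) (hmem y hy)
      (neg_le_neg (min_le_min_right Y hyz))
  have hRpos : ∀ y, 0 < y → 0 < R y := fun y hy => hr₁.trans_le (hRle y hy)
  have hRF : ∀ y, 0 < y → 0 < F M l (R y) := fun y hy => F_pos hM hl (h₁.trans_le (hRle y hy))
  set ρ : ℝ → ℝ := fun y => if y ≤ 0 then 0 else (R y)⁻¹ with hρ
  have hρ0 : ∀ y, y ≤ 0 → ρ y = 0 := fun y hy => if_pos hy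
  have hρ1 : ∀ y, 0 < y → ρ y = (R y)⁻¹ := fun y hy => if_neg (not_le.2 hy)
  have hρnn : ∀ y, 0 ≤ ρ y := by
    intro y
    rcases le_or_gt y 0 with hy | hy
    · rw [hρ0 y hy]
    · rw [hρ1 y hy]; exact (inv_pos.2 (hRpos y hy)).le
  have hρle : ∀ y, ρ y ≤ 1 / (4 * M) := by
    intro y
    rcases le_or_gt y 0 with hy | hy
    · rw [hρ0 y hy]; positivity
    · rw [hρ1 y hy, ← one_div]
      exact one_div_le_one_div_of_le (by positivity) (h4.trans (hRle y hy))
  have hρmono : Monotone ρ := by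
    intro x y hxy
    rcases le_or_gt x 0 with hx | hx
    · rw [hρ0 x hx]; exact hρnn y
    · rw [hρ1 x hx, hρ1 y (hx.trans_le hxy)]
      exact inv_anti₀ (hRpos y (hx.trans_le hxy)) (hRanti x y hx hxy)
  have hρc : Continuous ρ := by
    rw [continuous_iff_continuousAt]
    intro y
    rcases lt_trichotomy y 0 with hy | rfl | hy
    · have : ρ =ᶠ[𝓝 y] fun _ => 0 := by
        filter_upwards [gt_mem_nhds hy] with t ht using hρ0 t (le_of_lt ht)
      exact continuousAt_const.congr this.symm
    · rw [Metric.continuousAt_iff]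
      intro ε hε
      set N := max r₁ (1 / ε + 1) with hN
      have hN₁ : r₁ ≤ N := le_max_left _ _
      have hNε : 1 / ε < N := lt_of_lt_of_le (by linarith) (le_max_right _ _)
      have hNh : horizon M l < N := h₁.trans_le hN₁
      refine ⟨-tortoise M l N, by linarith [tortoise_neg hM hl hNh], fun t ht => ?_⟩
      rw [hρ0 0 le_rfl, Real.dist_eq, sub_zero, abs_of_nonneg (hρnn t)]
      rw [Real.dist_eq, sub_zero] at ht
      rcases le_or_gt t 0 with ht0 | ht0
      · rw [hρ0 t ht0]; exact hε
      · rw [abs_of_pos ht0] at ht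
        have h1 := min_le_left t Y
        have h2 : N ≤ R t := le_radius hM hl hNh ⟨by linarith, (hmem t ht0).2⟩
        rw [hρ1 t ht0]
        exact inv_lt_of_inv_lt₀ hε (by rw [← one_div]; exact hNε.trans_le h2)
    · have h1 : ContinuousAt (fun y => (R y)⁻¹) y :=
        (hRc.continuousAt (Ioi_mem_nhds hy)).inv₀ (hRpos y hy).ne'
      refine h1.congr ?_
      filter_upwards [lt_mem_nhds hy] with t ht using (hρ1 t ht).symm
  -- `A` written in `ρ = 1 / r`, a form that extends continuously to `ρ = 0` at the boundary `y =
  -- 0`.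
  set α : ℝ → ℝ := fun y => Real.sqrt (1 / l ^ 2 + ρ y ^ 2 - 2 * M * ρ y ^ 3) with hα
  set β : ℝ → ℝ := fun y => Real.sqrt (F M l (R y)) with hβ
  have hβc : ContinuousOn β (Ioi 0) := by
    refine ContinuousOn.sqrt (ContinuousOn.comp (t := Ioi 0) continuousOn_F hRc ?_)
    exact fun y hy => hRpos y hy
  obtain ⟨s, hsc, hsm, hs0, hspos, hsd⟩ := exists_monotone_weight (β := fun y => m * β y)
    (continuousOn_const.mul hβc) (fun y _ => mul_nonneg hm.le (Real.sqrt_nonneg _)) hY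
  have hα0 : α 0 = 1 / l := by
    simp only [hα, hρ0 0 le_rfl]
    rw [show (1 : ℝ) / l ^ 2 + 0 ^ 2 - 2 * M * 0 ^ 3 = (1 / l) ^ 2 by ring]
    exact Real.sqrt_sq (by positivity)
  refine ⟨α, β, s, ⟨by fun_prop, ?_, ?_, ?_, by fun_prop, ?_, ?_, hY⟩, hα0, ?_, ?_, hβc, hsc,
    hspos, hsd⟩
  · intro x _ y _ hxy
    apply Real.sqrt_le_sqrt
    have h1 := hρmono hxy
    have h2 := hρnn x
    have h3 := hρle x
    have h4' := hρle y
    generalize ρ x = p at *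
    generalize ρ y = q at *
    -- Here `ρ ≤ 1 / (4 M)` is used: it makes `ρ² - 2 M ρ³` increasing, through the factor `p + q -
    -- 2 M (p² + p q + q²)` of the difference.
    have h5 : 2 * M * (p + q) ≤ 1 := by
      have : 2 * M * (p + q) ≤ 2 * M * (1 / (4 * M) + 1 / (4 * M)) := by gcongr
      refine this.trans (le_of_eq ?_)
      field_simp
      norm_num
    have h6 : 0 ≤ p + q := by linarith
    have h7 : 2 * M * (p ^ 2 + p * q + q ^ 2) ≤ p + q := by
      have h8 := mul_le_mul_of_nonneg_right h5 h6
      have h9 : 0 ≤ 2 * M * (p * q) := by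
        have := mul_nonneg h2 (h2.trans h1)
        positivity
      nlinarith
    have := mul_nonneg (sub_nonneg.2 h1) (sub_nonneg.2 h7)
    nlinarith
  · refine ⟨Real.sqrt (1 / l ^ 2 + (1 / (4 * M)) ^ 2), fun y => ?_⟩
    rw [abs_of_nonneg (Real.sqrt_nonneg _)]
    apply Real.sqrt_le_sqrt
    have h1 : ρ y ^ 2 ≤ (1 / (4 * M)) ^ 2 := pow_le_pow_left₀ (hρnn y) (hρle y) 2
    have h2 : 0 ≤ 2 * M * ρ y ^ 3 := by
      have := hρnn y
      positivity
    linarith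
  · rw [hα0]; positivity
  · intro x y hxy
    exact pow_le_pow_left₀ (hs0 x) (hsm hxy) 2
  · intro y hy
    have := hspos y hy
    positivity
  · intro y hy
    have hRy : R y = radius M l (-y) := by simp only [hR, min_eq_left hy.2]
    have h0 := hRpos y hy.1
    simp only [hα, A, hρ1 y hy.1]
    rw [← hRy]
    have : 1 / l ^ 2 + (R y)⁻¹ ^ 2 - 2 * M * (R y)⁻¹ ^ 3 = F M l (R y) / R y ^ 2 := by
      rw [F]
      field_simp
      ring
    rw [this, Real.sqrt_div (hRF y hy.1).le, Real.sqrt_sq h0.le]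
  · intro y hy
    simp only [hβ, hR, B, min_eq_left hy.2]

end Profile

/-! ### Reduction to two real components and membership in the domain -/

/-- The spinors of a two-dimensional real subspace invariant under the Dirac operator. -/
noncomputable def spinor (u v : ℝ) : Spinor :=
  !₂[((u : ℂ) - Complex.I * v) / 2, (-(u : ℂ) - Complex.I * v) / 2,
    ((u : ℂ) + Complex.I * v) / 2, ((u : ℂ) - Complex.I * v) / 2]

theorem norm_spinor_sq (u v : ℝ) : ‖spinor u v‖ ^ 2 = u ^ 2 + v ^ 2 := by
  rw [EuclideanSpace.norm_sq_eq, Fin.sum_univ_four]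
  simp only [spinor, ← Complex.normSq_eq_norm_sq]
  simp [Complex.normSq_apply]
  ring

theorem spinor_eq (u v : ℝ) : spinor u v = u • spinor 1 0 + v • spinor 0 1 := by
  ext i
  fin_cases i <;> simp [spinor] <;> ring

theorem spinor_add (u v u' v' : ℝ) : spinor u v + spinor u' v' = spinor (u + u') (v + v') := by
  rw [spinor_eq u, spinor_eq u', spinor_eq (u + u')]
  module

theorem smul_spinor (c u v : ℝ) : (c : ℂ) • spinor u v = spinor (c * u) (c * v) := by
  ext i
  fin_cases i <;> simp [spinor] <;> ring

theorem spinor_zero : spinor 0 0 = 0 := by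
  rw [spinor_eq]; simp

theorem continuousOn_spinor {f g : ℝ → ℝ} {s : Set ℝ} (hf : ContinuousOn f s)
    (hg : ContinuousOn g s) : ContinuousOn (fun x => spinor (f x) (g x)) s := by
  have : ∀ x, spinor (f x) (g x) = f x • spinor 1 0 + g x • spinor 0 1 := fun x => spinor_eq _ _
  simp only [this]
  fun_prop

theorem hasDerivAt_spinor {f g : ℝ → ℝ} {f' g' x : ℝ} (hf : HasDerivAt f f' x)
    (hg : HasDerivAt g g' x) :
    HasDerivAt (fun x => spinor (f x) (g x)) (spinor f' g') x := by
  have : ∀ x, spinor (f x) (g x) = f x • spinor 1 0 + g x • spinor 0 1 := fun x => spinor_eq _ _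
  simp only [this]
  rw [spinor_eq f' g']
  exact (hf.smul_const (spinor 1 0)).add (hg.smul_const (spinor 0 1))

/-- On this family the kinetic matrix is `h` times a rotation by a quarter turn, so the Dirac
equation becomes a real planar system. -/
theorem kinetic_spinor (h u v : ℝ) :
    Matrix.toEuclideanLin ((Complex.I * (h : ℂ)) • (γ0 * γ1)) (spinor u v) =
      spinor (-(h * v)) (h * u) := by
  ext i
  fin_cases i <;>
    simp [spinor, γ0, γ1, Matrix.toLpLin_apply] <;> ring_nf <;> simp <;> ring

theorem potential_spinor (M l m h x u v : ℝ) :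
    Matrix.toEuclideanLin (potential M l m h x) (spinor u v) =
      spinor (A M l x * u + h * m * B M l x * v) (-(A M l x * v) + h * m * B M l x * u) := by
  ext i
  fin_cases i <;>
    simp [spinor, potential, γ0, γ2, Matrix.toLpLin_apply] <;> ring_nf <;> simp <;> ring

theorem norm_toLp_sq {f : ℝ → Spinor} (hf : MemLp f 2 (volume.restrict (Iio (0 : ℝ)))) :
    ‖hf.toLp f‖ ^ 2 = ∫ x in Iio (0 : ℝ), ‖f x‖ ^ 2 := by
  have h1 : ((‖hf.toLp f‖ ^ 2 : ℝ) : ℂ) = ((∫ x in Iio (0 : ℝ), ‖f x‖ ^ 2 : ℝ) : ℂ) := by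
    have h2 := inner_self_eq_norm_sq_to_K (𝕜 := ℂ) (hf.toLp f)
    rw [L2.inner_def] at h2
    push_cast
    refine h2.symm.trans ?_
    rw [← integral_complex_ofReal]
    refine integral_congr_ae ?_
    filter_upwards [hf.coeFn_toLp] with x hx
    rw [hx, inner_self_eq_norm_sq_to_K]
    push_cast
    rfl
  exact_mod_cast h1

/-- A square integrable function which is differentiable on `]-∞, 0[`, with square integrable
pointwise image, belongs to the domain. -/
theorem isDiracImage_of_hasDerivAt {M l m h : ℝ} {f f' g : ℝ → Spinor}
    (hf : MemLp f 2 (volume.restrict (Iio (0 : ℝ))))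
    (hg : MemLp g 2 (volume.restrict (Iio (0 : ℝ))))
    (hd : ∀ x < 0, HasDerivAt f (f' x) x) (hc : ContinuousOn f' (Iio 0))
    (he : ∀ x < 0, g x = Matrix.toEuclideanLin ((Complex.I * (h : ℂ)) • (γ0 * γ1)) (f' x) +
      Matrix.toEuclideanLin (potential M l m h x) (f x)) :
    IsDiracImage M l m h (hf.toLp f) (hg.toLp g) := by
  intro η hη hηc hηs
  set T := Matrix.toEuclideanLin ((Complex.I * (h : ℂ)) • (γ0 * γ1)) with hT
  have hηd : ∀ x, HasDerivAt η (deriv η x) x := fun x =>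
    (hη.differentiable (by simp) x).hasDerivAt
  have hη'c : Continuous (deriv η) := hη.continuous_deriv (by simp)
  -- Extended by zero, `η f` is a compactly supported `C¹` function on `ℝ`. The integral of its
  -- derivative vanishes, which is the integration by parts.
  set G : ℝ → Spinor := fun x => η x • f x with hG
  set G' : ℝ → Spinor := fun x => η x • f' x + deriv η x • f x with hG'
  have hout : ∀ x, 0 ≤ x → x ∉ tsupport η := fun x hx hmem => absurd (hηs hmem) (not_lt.2 hx)
  have hev : ∀ x, 0 ≤ x → ∀ᶠ t in 𝓝 x, η t = 0 ∧ deriv η t = 0 := by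
    intro x hx
    filter_upwards [(isClosed_tsupport η).isOpen_compl.mem_nhds (hout x hx)] with t ht
    exact ⟨image_eq_zero_of_notMem_tsupport ht,
      image_eq_zero_of_notMem_tsupport fun h' => ht (tsupport_deriv_subset h')⟩
  have hGd : ∀ x, HasDerivAt G (G' x) x := by
    intro x
    rcases lt_or_ge x 0 with hx | hx
    · exact (hηd x).smul (hd x hx)
    · have h1 : G =ᶠ[𝓝 x] fun _ => 0 := by
        filter_upwards [hev x hx] with t ht
        simp [hG, ht.1]
      have h2 : G' x = 0 := by
        have := (hev x hx).self_of_nhds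
        simp [hG', this.1, this.2]
      rw [h2]
      exact (hasDerivAt_const x (0 : Spinor)).congr_of_eventuallyEq h1
  have hG'c : Continuous G' := by
    rw [continuous_iff_continuousAt]
    intro x
    rcases lt_or_ge x 0 with hx | hx
    · exact (hη.continuous.continuousAt.smul (hc.continuousAt (Iio_mem_nhds hx))).add
        (hη'c.continuousAt.smul (hd x hx).continuousAt)
    · have h1 : G' =ᶠ[𝓝 x] fun _ => 0 := by
        filter_upwards [hev x hx] with t ht
        simp [hG', ht.1, ht.2]
      exact continuousAt_const.congr h1.symm
  have hGc : Continuous G := continuous_iff_continuousAt.2 fun x => (hGd x).continuousAt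
  have hGi : Integrable G := hGc.integrable_of_hasCompactSupport hηc.smul_right
  have hG'i : Integrable G' := hG'c.integrable_of_hasCompactSupport
    (HasCompactSupport.add (hηc.smul_right) (hηc.deriv.smul_right))
  have hzero : ∫ x in Iio (0 : ℝ), G' x = 0 := by
    rw [setIntegral_eq_integral_of_forall_compl_eq_zero]
    · exact integral_eq_zero_of_hasDerivAt_of_integrable hGd hG'i hGi
    · intro x hx
      have := (hev x (not_lt.1 hx)).self_of_nhds
      simp [hG', this.1, this.2]
  have hTi : IntegrableOn (fun x => T.toContinuousLinearMap (G' x)) (Iio 0) :=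
    (T.toContinuousLinearMap.integrable_comp hG'i).integrableOn
  have hT0 : ∫ x in Iio (0 : ℝ), T.toContinuousLinearMap (G' x) = 0 := by
    rw [T.toContinuousLinearMap.integral_comp_comm hG'i.integrableOn, hzero, map_zero]
  have hgi : IntegrableOn (fun x => η x • g x) (Iio 0) :=
    (hg.locallyIntegrable (by norm_num)).integrable_smul_left_of_hasCompactSupport
      hη.continuous hηc
  have e1 : ∫ x in Iio (0 : ℝ), η x • (hg.toLp g) x = ∫ x in Iio (0 : ℝ), η x • g x := by
    refine integral_congr_ae ?_
    filter_upwards [hg.coeFn_toLp] with x hx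
    rw [hx]
  rw [e1]
  have e2 : ∫ x in Iio (0 : ℝ), (η x • g x - T.toContinuousLinearMap (G' x)) =
      ∫ x in Iio (0 : ℝ), η x • g x := by
    rw [integral_sub hgi hTi, hT0, sub_zero]
  rw [← e2]
  refine integral_congr_ae ?_
  filter_upwards [hf.coeFn_toLp, ae_restrict_mem measurableSet_Iio] with x hx hx0
  rw [hx, he x hx0]
  have e3 : T.toContinuousLinearMap (G' x) = η x • T (f' x) + deriv η x • T (f x) := by
    simp only [hG', LinearMap.coe_toContinuousLinearMap', map_add]
    rw [LinearMap.map_smul_of_tower, LinearMap.map_smul_of_tower]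
  rw [e3]
  module

theorem memLp_of_continuous_of_eq_zero {f : ℝ → Spinor} {c : ℝ}
    (hf : ContinuousOn f (Iic 0)) (h0 : ∀ x < c, f x = 0) :
    MemLp f 2 (volume.restrict (Iio (0 : ℝ))) := by
  have hm : AEStronglyMeasurable f (volume.restrict (Iio (0 : ℝ))) :=
    (hf.mono Iio_subset_Iic_self).aestronglyMeasurable measurableSet_Iio
  rw [memLp_two_iff_integrable_sq_norm hm]
  have h1 : IntegrableOn (fun x => ‖f x‖ ^ 2) (Icc c 0) :=
    ((hf.mono Icc_subset_Iic_self).norm.pow 2).integrableOn_Icc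
  refine IntegrableOn.of_forall_sdiff_eq_zero h1 measurableSet_Iio fun x hx => ?_
  have : x < c := by
    by_contra! h2
    exact hx.2 ⟨h2, le_of_lt hx.1⟩
  simp [h0 x this]

theorem integral_comp_neg_eq {k : ℝ → ℝ} {Y : ℝ} (hY : 0 < Y) (h0 : ∀ y, Y ≤ y → k y = 0) :
    ∫ x in Iio (0 : ℝ), k (-x) = ∫ y in (0 : ℝ)..Y, k y := by
  rw [← integral_Iic_eq_integral_Iio, integral_comp_neg_Iic, neg_zero,
    intervalIntegral.integral_of_le hY.le]
  refine setIntegral_eq_of_subset_of_forall_sdiff_eq_zero measurableSet_Ioi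
    Ioc_subset_Ioi_self fun y hy => h0 y ?_
  by_contra! h
  exact hy.2 ⟨hy.1, h.le⟩

/-! ### Truncation and normalized quasimodes -/

/-- A truncated regular solution lies in the domain, and the defect is the commutator with the
truncation. -/
theorem exists_truncated {M l m h lam Y : ℝ} {α β s w b κ κ' : ℝ → ℝ} (hh : 0 < h)
    (hD : IsRadialData α (fun y => s y ^ 2) Y)
    (hS : IsRegularSolution α (fun y => s y ^ 2) h lam w b)
    (hαA : ∀ y ∈ Ioc 0 Y, α y = A M l (-y)) (hβB : ∀ y ∈ Ioc 0 Y, β y = B M l (-y))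
    (hβc : ContinuousOn β (Ioi 0)) (hsc : Continuous s) (hspos : ∀ y, 0 < y → 0 < s y)
    (hsd : ∀ y, 0 < y → HasDerivAt s (m * β y * s y) y)
    (hκ : ∀ y, HasDerivAt κ (κ' y) y) (hκ'c : Continuous κ')
    (hκ0 : ∀ y, Y ≤ y → κ y = 0) (hκ'0 : ∀ y, Y ≤ y → κ' y = 0) :
    ∃ φ ψ : L2, IsDiracImage M l m h φ ψ ∧
      ‖φ‖ ^ 2 = ∫ y in (0 : ℝ)..Y, κ y ^ 2 * (s y ^ 2 * (w y ^ 2 + b y ^ 2)) ∧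
      ‖ψ - (lam : ℂ) • φ‖ ^ 2 =
        ∫ y in (0 : ℝ)..Y, (h * κ' y) ^ 2 * (s y ^ 2 * (w y ^ 2 + b y ^ 2)) ∧
      ∀ᵐ x ∂(volume.restrict (Iio (-Y))), φ x = 0 := by
  have hα := hD.continuous_α
  have hwc := hS.continuous_w
  have hbc := hS.continuous_b
  have hY := hD.Y_pos
  have hκc : Continuous κ := continuous_iff_continuousAt.2 fun y => (hκ y).continuousAt
  set u : ℝ → ℝ := fun y => s y * w y with hu
  set v : ℝ → ℝ := fun y => s y * b y with hv
  have huc : Continuous u := hsc.mul hwc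
  have hvc : Continuous v := hsc.mul hbc
  -- The Dirac system for `(s w, s b)`: differentiating the weight restores the mass terms `± m β`.
  set u' : ℝ → ℝ := fun y => m * β y * u y - (lam + α y) / h * v y with hu'
  set v' : ℝ → ℝ := fun y => (lam - α y) / h * u y - m * β y * v y with hv'
  have hud : ∀ y, 0 < y → HasDerivAt u (u' y) y := by
    intro y hy
    refine ((hsd y hy).mul (hS.hasDerivAt_w hα hy)).congr_deriv ?_
    simp only [hu', hu, hv]
    ring
  have hvd : ∀ y, 0 < y → HasDerivAt v (v' y) y := by
    intro y hy
    have h0 := (hspos y hy).ne'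
    have h1 := (hS.hasDerivAt_z hα hD.continuous_a hy).fun_div (hsd y hy) h0
    refine (h1.congr_of_eventuallyEq ?_).congr_deriv ?_
    · filter_upwards [lt_mem_nhds hy] with t ht
      have := (hspos t ht).ne'
      simp only [hv]
      field_simp
    · simp only [hv', hu, hv]
      field_simp
  set U' : ℝ → ℝ := fun y => κ' y * u y + κ y * u' y with hU'
  set V' : ℝ → ℝ := fun y => κ' y * v y + κ y * v' y with hV'
  have hUd : ∀ y, 0 < y → HasDerivAt (fun y => κ y * u y) (U' y) y := fun y hy =>
    (hκ y).mul (hud y hy)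
  have hVd : ∀ y, 0 < y → HasDerivAt (fun y => κ y * v y) (V' y) y := fun y hy =>
    (hκ y).mul (hvd y hy)
  have hU'c : ContinuousOn U' (Ioi 0) := by fun_prop
  have hV'c : ContinuousOn V' (Ioi 0) := by fun_prop
  have hneg : MapsTo (fun x : ℝ => -x) (Iio 0) (Ioi 0) := by
    intro x hx
    exact neg_pos.2 (mem_Iio.1 hx)
  set f : ℝ → Spinor := fun x => spinor (κ (-x) * u (-x)) (κ (-x) * v (-x)) with hf
  set f' : ℝ → Spinor := fun x => spinor (U' (-x) * -1) (V' (-x) * -1) with hf'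
  -- The commutator of the kinetic term with the cutoff, the only part of the image other than `lam
  -- • f`.
  set g₀ : ℝ → Spinor := fun x => spinor (h * κ' (-x) * v (-x)) (-(h * κ' (-x) * u (-x)))
    with hg₀
  have hfc : ContinuousOn f (Iic 0) :=
    continuousOn_spinor (by fun_prop) (by fun_prop)
  have hg₀c : ContinuousOn g₀ (Iic 0) :=
    continuousOn_spinor (by fun_prop) (by fun_prop)
  have hf0 : ∀ x < -Y, f x = 0 := by
    intro x hx
    simp only [hf, hκ0 (-x) (by linarith), zero_mul, spinor_zero]
  have hg₀0 : ∀ x < -Y, g₀ x = 0 := by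
    intro x hx
    simp only [hg₀, hκ'0 (-x) (by linarith), mul_zero, zero_mul, neg_zero, spinor_zero]
  have hfm := memLp_of_continuous_of_eq_zero hfc hf0
  have hgm := memLp_of_continuous_of_eq_zero hg₀c hg₀0
  have hfd : ∀ x < 0, HasDerivAt f (f' x) x := by
    intro x hx
    exact hasDerivAt_spinor
      (HasDerivAt.comp x (hUd (-x) (neg_pos.2 hx)) (hasDerivAt_neg x))
      (HasDerivAt.comp x (hVd (-x) (neg_pos.2 hx)) (hasDerivAt_neg x))
  have hf'c : ContinuousOn f' (Iio 0) := by
    refine continuousOn_spinor (ContinuousOn.mul ?_ continuousOn_const)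
      (ContinuousOn.mul ?_ continuousOn_const)
    · exact hU'c.comp continuous_neg.continuousOn hneg
    · exact hV'c.comp continuous_neg.continuousOn hneg
  have himg := isDiracImage_of_hasDerivAt (M := M) (l := l) (m := m) (h := h)
    (g := (lam : ℂ) • f + g₀) hfm ((hfm.const_smul (lam : ℂ)).add hgm) hfd hf'c (by
      intro x hx
      rw [hf', kinetic_spinor, hf, potential_spinor, spinor_add]
      simp only [Pi.add_apply, Pi.smul_apply, hg₀]
      rw [smul_spinor, spinor_add]
      have hx0 : 0 < -x := neg_pos.2 hx
      rcases le_or_gt (-x) Y with hxY | hxY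
      · have hA := hαA (-x) ⟨hx0, hxY⟩
        have hB := hβB (-x) ⟨hx0, hxY⟩
        rw [neg_neg] at hA hB
        rw [← hA, ← hB]
        congr 1
        · simp only [hV', hv']
          field_simp
          ring
        · simp only [hU', hu']
          field_simp
          ring
      -- Beyond `Y` the coefficients need not agree with `A` and `B`, but the cutoff and its
      -- derivative vanish there.
      · simp only [hU', hV', hκ0 (-x) hxY.le, hκ'0 (-x) hxY.le]
        simp)
  refine ⟨hfm.toLp f, _, himg, ?_, ?_, ?_⟩
  · rw [norm_toLp_sq, ← integral_comp_neg_eq hY]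
    · refine integral_congr_ae (Eventually.of_forall fun x => ?_)
      simp only [hf, norm_spinor_sq, hu, hv]
      ring
    · intro y hy
      simp [hκ0 y hy]
  · have e : ((hfm.const_smul (lam : ℂ)).add hgm).toLp ((lam : ℂ) • f + g₀) -
        (lam : ℂ) • hfm.toLp f = hgm.toLp g₀ := by
      rw [MemLp.toLp_add (hfm.const_smul (lam : ℂ)) hgm, MemLp.toLp_const_smul (lam : ℂ) hfm,
        add_sub_cancel_left]
    rw [e, norm_toLp_sq, ← integral_comp_neg_eq hY]
    · refine integral_congr_ae (Eventually.of_forall fun x => ?_)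
      simp only [hg₀, norm_spinor_sq, hu, hv]
      ring
    · intro y hy
      simp [hκ'0 y hy]
  · have h1 := ae_restrict_of_ae_restrict_of_subset (t := Iio (0 : ℝ)) (s := Iio (-Y))
      (Iio_subset_Iio (by linarith)) hfm.coeFn_toLp
    filter_upwards [h1, ae_restrict_mem measurableSet_Iio] with x hx hx0
    rw [hx, hf0 x hx0]

/-- A smooth function equal to `1` on `]-∞, c]` and to `0` on `[d, ∞[`. -/
theorem exists_cutoff {c d : ℝ} (hcd : c < d) :
    ∃ χ χ' : ℝ → ℝ, ∃ K, (∀ y, HasDerivAt χ (χ' y) y) ∧ Continuous χ' ∧ (∀ y, y ≤ c → χ y = 1) ∧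
      (∀ y, d ≤ y → χ y = 0) ∧ (∀ y, y ≤ c → χ' y = 0) ∧ (∀ y, d ≤ y → χ' y = 0) ∧
      ∀ y ∈ Icc c d, |χ' y| ≤ K := by
  set χ : ℝ → ℝ := fun y => Real.smoothTransition ((d - y) / (d - c)) with hχ
  have hdc : 0 < d - c := sub_pos.2 hcd
  have hsm : ContDiff ℝ 1 χ := Real.smoothTransition.contDiff.comp (by fun_prop)
  have hd : ∀ y, HasDerivAt χ (deriv χ y) y := fun y =>
    (hsm.differentiable (by simp) y).hasDerivAt
  have hc : Continuous (deriv χ) := hsm.continuous_deriv (by simp)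
  have h1 : ∀ y, y ≤ c → χ y = 1 := fun y hy =>
    Real.smoothTransition.one_of_one_le (by rw [le_div_iff₀ hdc]; linarith)
  have h0 : ∀ y, d ≤ y → χ y = 0 := fun y hy =>
    Real.smoothTransition.zero_of_nonpos (div_nonpos_of_nonpos_of_nonneg (by linarith) hdc.le)
  obtain ⟨K, hK⟩ := isCompact_Icc.exists_bound_of_continuousOn (s := Icc c d) hc.continuousOn
  refine ⟨χ, deriv χ, K, hd, hc, h1, h0, fun y hy => ?_, fun y hy => ?_, hK⟩
  -- On the flat parts, endpoints included, `χ` attains its extreme values `1` and `0`, so its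
  -- derivative vanishes.
  · have hmax : IsLocalMax χ y := Eventually.of_forall fun t => by
      rw [h1 y hy]; exact Real.smoothTransition.le_one _
    exact hmax.hasDerivAt_eq_zero (hd y)
  · have hmin : IsLocalMin χ y := Eventually.of_forall fun t => by
      rw [h0 y hy]; exact Real.smoothTransition.nonneg _
    exact hmin.hasDerivAt_eq_zero (hd y)

/-- Normalized quasimodes with exponentially small defect. -/
theorem exists_quasimode {M l m lam1 Y : ℝ} {α β s : ℝ → ℝ}
    (hD : IsRadialData α (fun y => s y ^ 2) Y) (h01 : α 0 < lam1) (h1Y : lam1 < α Y)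
    (hαA : ∀ y ∈ Ioc 0 Y, α y = A M l (-y)) (hβB : ∀ y ∈ Ioc 0 Y, β y = B M l (-y))
    (hβc : ContinuousOn β (Ioi 0)) (hsc : Continuous s) (hspos : ∀ y, 0 < y → 0 < s y)
    (hsd : ∀ y, 0 < y → HasDerivAt s (m * β y * s y) y) :
    ∃ h₀ > 0, ∃ D > 0, ∀ h, 0 < h → h < h₀ → ∃ lam ∈ Icc (α 0) lam1, ∃ φ ψ : L2,
      IsDiracImage M l m h φ ψ ∧ ‖φ‖ = 1 ∧ ‖ψ - (lam : ℂ) • φ‖ ≤ Real.exp (-D / h) ∧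
      ∀ᵐ x ∂(volume.restrict (Iio (-Y))), φ x = 0 := by
  obtain ⟨c, hc, C, hC, d, hd, h₁, hh₁, hconc⟩ := hD.exists_concentrated h01 h1Y
  obtain ⟨χ, χ', K, hχ, hχ'c, hχ1, hχ0, hχ'1, hχ'0, hχK⟩ := exists_cutoff hc.2
  set C' := K ^ 2 * C + 1 with hC'
  have hC'0 : 0 < C' := by positivity
  -- The squared defect is at most `C' exp (-d / h)`. For `h < d / (2 C')` the constant is absorbed
  -- by `exp (d / (2 h))`, leaving `exp (-d / (2 h))`; the square root gives `D = d / 4`.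
  refine ⟨min (min h₁ 1) (d / (2 * C')), by positivity, d / 4, by positivity,
    fun h hh hlt => ?_⟩
  have hlt₁ : h < h₁ := hlt.trans_le ((min_le_left _ _).trans (min_le_left _ _))
  have hlt1 : h < 1 := hlt.trans_le ((min_le_left _ _).trans (min_le_right _ _))
  have hltd : h < d / (2 * C') := hlt.trans_le (min_le_right _ _)
  obtain ⟨lam, hlam, w, b, hS, hIpos, hIle⟩ := hconc h hh hlt₁
  have hQc := hD.continuous_density hS
  set Q : ℝ → ℝ := fun t => s t ^ 2 * (w t ^ 2 + b t ^ 2) with hQ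
  have hQ0 : ∀ t, 0 ≤ Q t := fun t => by positivity
  have hχc : Continuous χ := continuous_iff_continuousAt.2 fun y => (hχ y).continuousAt
  set I := ∫ t in (0 : ℝ)..c, Q t with hI
  set N := ∫ t in (0 : ℝ)..Y, χ t ^ 2 * Q t with hN
  have hIN : I ≤ N := by
    have h1 : Continuous fun t => χ t ^ 2 * Q t := by fun_prop
    have e1 : ∫ t in (0 : ℝ)..c, χ t ^ 2 * Q t = I := by
      refine intervalIntegral.integral_congr fun t ht => ?_
      rw [uIcc_of_le hc.1.le] at ht
      simp [hχ1 t ht.2]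
    rw [hN, ← intervalIntegral.integral_add_adjacent_intervals
      (h1.intervalIntegrable 0 c) (h1.intervalIntegrable c Y), e1]
    have : 0 ≤ ∫ t in c..Y, χ t ^ 2 * Q t :=
      intervalIntegral.integral_nonneg hc.2.le fun t _ => mul_nonneg (sq_nonneg _) (hQ0 t)
    linarith
  have hNpos : 0 < N := hIpos.trans_le hIN
  have hcomm : ∫ t in (0 : ℝ)..Y, (h * χ' t) ^ 2 * Q t ≤ K ^ 2 * ∫ t in c..Y, Q t := by
    have h1 : Continuous fun t => (h * χ' t) ^ 2 * Q t := by fun_prop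
    have e1 : ∫ t in (0 : ℝ)..c, (h * χ' t) ^ 2 * Q t = 0 := by
      rw [intervalIntegral.integral_congr (g := fun _ => 0), intervalIntegral.integral_zero]
      intro t ht
      rw [uIcc_of_le hc.1.le] at ht
      simp [hχ'1 t ht.2]
    rw [← intervalIntegral.integral_add_adjacent_intervals
      (h1.intervalIntegrable 0 c) (h1.intervalIntegrable c Y), e1, zero_add,
      ← intervalIntegral.integral_const_mul]
    refine intervalIntegral.integral_mono_on hc.2.le (h1.intervalIntegrable _ _)
      ((hQc.const_mul _).intervalIntegrable _ _) fun t ht => ?_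
    refine mul_le_mul_of_nonneg_right ?_ (hQ0 t)
    rw [← sq_abs, abs_mul, abs_of_pos hh]
    have h2 := hχK t ht
    refine pow_le_pow_left₀ (by positivity) ?_ 2
    calc h * |χ' t| ≤ 1 * |χ' t| := by gcongr
      _ ≤ K := by rw [one_mul]; exact h2
  set k := (Real.sqrt N)⁻¹ with hk
  have hk2 : k ^ 2 * N = 1 := by
    rw [hk, inv_pow, Real.sq_sqrt hNpos.le, inv_mul_cancel₀ hNpos.ne']
  obtain ⟨φ, ψ, himg, hφ, hψ, hsupp⟩ := exists_truncated (κ := fun y => k * χ y)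
    (κ' := fun y => k * χ' y) hh hD hS hαA hβB hβc hsc hspos hsd
    (fun y => (hχ y).const_mul k) (by fun_prop) (fun y hy => by simp [hχ0 y hy])
    (fun y hy => by simp [hχ'0 y hy])
  refine ⟨lam, hlam, φ, ψ, himg, ?_, ?_, hsupp⟩
  · have e : ‖φ‖ ^ 2 = 1 := by
      rw [hφ, ← hk2, hN, ← intervalIntegral.integral_const_mul]
      refine intervalIntegral.integral_congr fun t _ => ?_
      simp only [hQ]
      ring
    exact (pow_eq_one_iff_of_nonneg (norm_nonneg _) two_ne_zero).1 e
  · have e : ‖ψ - (lam : ℂ) • φ‖ ^ 2 = k ^ 2 * ∫ t in (0 : ℝ)..Y, (h * χ' t) ^ 2 * Q t := by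
      rw [hψ, ← intervalIntegral.integral_const_mul]
      refine intervalIntegral.integral_congr fun t _ => ?_
      simp only [hQ]
      ring
    have h1 : ‖ψ - (lam : ℂ) • φ‖ ^ 2 ≤ C' * Real.exp (-d / h) := by
      rw [e]
      have hle : K ^ 2 * ∫ t in c..Y, Q t ≤ K ^ 2 * (C * Real.exp (-d / h) * N) := by
        refine mul_le_mul_of_nonneg_left (hIle.trans ?_) (sq_nonneg K)
        gcongr
      calc _ ≤ k ^ 2 * (K ^ 2 * (C * Real.exp (-d / h) * N)) :=
            mul_le_mul_of_nonneg_left (hcomm.trans hle) (sq_nonneg k)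
        _ = (k ^ 2 * N) * (K ^ 2 * C * Real.exp (-d / h)) := by ring
        _ ≤ C' * Real.exp (-d / h) := by
          rw [hk2, one_mul]
          gcongr
          linarith
    have h2 : C' ≤ Real.exp (d / (2 * h)) := by
      have h3 : C' ≤ d / (2 * h) := by
        rw [lt_div_iff₀ (by positivity)] at hltd
        rw [le_div_iff₀ (by positivity)]
        linarith
      linarith [Real.add_one_le_exp (d / (2 * h))]
    have h3 : ‖ψ - (lam : ℂ) • φ‖ ^ 2 ≤ Real.exp (-(d / 4) / h) ^ 2 := by
      refine h1.trans ((mul_le_mul_of_nonneg_right h2 (Real.exp_pos _).le).trans (le_of_eq ?_))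
      rw [← Real.exp_add, ← Real.exp_nat_mul]
      congr 1
      field_simp
      norm_num
    exact (pow_le_pow_iff_left₀ (norm_nonneg _) (Real.exp_pos _).le two_ne_zero).1 h3

end SAdS

/-! ### The quasimode theorem -/

theorem mainTheorem2 (M l m : ℝ) (hM : 0 < M) (hl : 0 < l) (hml : 1 < m * l)
    (rp : ℝ)
    (hrp : ∀ r : ℝ, rp ≤ r →
      0 ≤ SAdS.F M l r / (4 * l ^ 2) - (deriv (SAdS.F M l) r) ^ 2 / 16)
    (S : ℝ) (hS : 0 < S)
    (hSA : 1 / l ^ 2 + S < (SAdS.A M l (SAdS.tortoise M l rp)) ^ 2) :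
    ∃ h₀ : ℝ, 0 < h₀ ∧ ∃ D : ℝ, 0 < D ∧
      ∃ (E : ℝ → ℝ) (φ : ℝ → SAdS.L2), ∀ h : ℝ, 0 < h → h < h₀ →
        0 < E h ∧ E h < 1 / l ^ 2 + S ∧
        φ h ∈ SAdS.domain M l m h ∧ ‖φ h‖ = 1 ∧
        (∀ᵐ x ∂(volume.restrict (Iio (SAdS.tortoise M l rp))), φ h x = 0) ∧
        ‖SAdS.dirac M l m h (φ h) - (Real.sqrt (E h) : ℂ) • φ h‖ ≤ Real.exp (-D / h) := by
  have hm : 0 < m := by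
    by_contra! h
    have := mul_nonpos_of_nonpos_of_nonneg h hl.le
    linarith
  have h₁ := SAdS.horizon_lt_of_nonneg hM hl hrp
  have h4 := SAdS.four_mul_le_of_nonneg hM hl ((SAdS.horizon_pos hM hl).trans h₁) (hrp rp le_rfl)
  obtain ⟨α, β, s, hD, hα0, hαA, hβB, hβc, hsc, hspos, hsd⟩ :=
    SAdS.exists_radialData hM hl hm h₁ h4
  have hl0 : 0 < 1 / l := by positivity
  have hY := hD.Y_pos
  have hαY := hαA _ ⟨hY, le_rfl⟩
  rw [neg_neg] at hαY
  have hαY0 : 0 < α (-SAdS.tortoise M l rp) := hD.α_pos.trans_le (hD.α_le ⟨hY.le, le_rfl⟩)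
  rw [← hαY, ← Real.sqrt_lt' hαY0] at hSA
  have hlow : α 0 < Real.sqrt (1 / l ^ 2 + S) := by
    rw [hα0, Real.lt_sqrt hl0.le, div_pow, one_pow]
    linarith
  -- Strictly between `1 / l` and `√(1 / l² + S)`, so that `lam ≤ lam1` still gives the strict upper
  -- bound on `lam ^ 2`.
  obtain ⟨lam1, h01, h1S⟩ := exists_between hlow
  obtain ⟨h₀, hh₀, D, hD0, hquasi⟩ :=
    SAdS.exists_quasimode hD h01 (h1S.trans hSA) hαA hβB hβc hsc hspos hsd
  have hchoice : ∀ h : ℝ, ∃ (e : ℝ) (f : SAdS.L2), 0 < h → h < h₀ →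
      0 < e ∧ e < 1 / l ^ 2 + S ∧ f ∈ SAdS.domain M l m h ∧ ‖f‖ = 1 ∧
      (∀ᵐ x ∂(volume.restrict (Iio (SAdS.tortoise M l rp))), f x = 0) ∧
      ‖SAdS.dirac M l m h f - (Real.sqrt e : ℂ) • f‖ ≤ Real.exp (-D / h) := by
    intro h
    by_cases hh : 0 < h ∧ h < h₀
    · obtain ⟨lam, hlam, f, g, himg, hf1, hfg, hsupp⟩ := hquasi h hh.1 hh.2
      have hlam0 : 0 < lam := hD.α_pos.trans_le hlam.1
      refine ⟨lam ^ 2, f, fun _ _ => ⟨by positivity, ?_, ⟨g, himg⟩, hf1, ?_, ?_⟩⟩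
      · exact (Real.lt_sqrt hlam0.le).1 (hlam.2.trans_lt h1S)
      · rwa [neg_neg] at hsupp
      · rw [SAdS.dirac_eq himg, Real.sqrt_sq hlam0.le]
        exact hfg
    -- Default values for `h` outside the admissible range, needed because `E` and `φ` are functions
    -- on all of `ℝ`.
    · exact ⟨0, 0, fun h1 h2 => absurd ⟨h1, h2⟩ hh⟩
  choose E φ hEφ using hchoice
  exact ⟨h₀, hh₀, D, hD0, E, φ, hEφ⟩
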